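/- **Notation.** Write $e(x)=\mathrm e^{2\pi\mathrm i x}$, $\mathbb T=\mathbb R/\mathbb Z$, $\{x\}$ for the fractional part and $\|x\|$ for the distance of $x\in\mathbb R$ to the nearest integer. For $\alpha\in\mathbb R$ let $\Lambda_\alpha(p,q)=(p+\alpha,\,q+p)$ be the skew translation of $\mathbb T^2$, and for $k,\ell\in\mathbb Z$ let $\psi_{k,\ell}(p,q)=e(kp+\ell q)$ and $$S_{N,\alpha}[\psi_{k,\ell}]=\sum_{n=1}^N\psi_{k,\ell}\circ\Lambda_\alpha^n .$$ For $u\in\mathbb R$ and $N\in\mathbb N=\{1,2,\dots\}$ let $c_N(u)=\min\{c\in\mathbb N:\|cu\|\le 1/N\}$, let $d_N(u)$ be the unique integer with $-\tfrac12\le c_N(u)u+d_N(u)<\tfrac12$ (it is coprime to $c_N(u)$), and let $a_N(u)$ be an inverse of $d_N(u)$ modulo $c_N(u)$. Let $\widetilde\rho_{N,\alpha}$ be the law on $\mathbb C$ of $$\widetilde X_{N,\alpha}=\frac{S_{N,\alpha}[\psi_{k,\ell}](p,q)}{\sqrt{c_N(\ell\alpha)}},$$ where $(p,q)$ is uniformly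 distributed in $\mathbb T^2$. For $\omega,\varphi\in\mathbb R$ let $\nu_{\omega,\varphi}$ be the law on $\mathbb C$ of $$Y_{\omega,\varphi}=\frac{e(t)}{2\pi}\,\Bigg|\sum_{n\in\mathbb Z}\frac{1+e(t'-n\varphi)}{n-y}\;e\big(\tfrac12(n-y)^2\omega+nx\big)\Bigg| ,$$ where $(t,t',x,y)$ is uniformly distributed in $[0,1)^4$ and the series, which is not absolutely convergent, is understood as the limit in probability of its partial sums over finite sets $s\subset\mathbb Z$ (along the finite subsets of $\mathbb Z$ directed by inclusion); this limit exists. **Theorem.** Let $\alpha\in\mathbb R$, $k\in\mathbb Z$, $\ell\in\mathbb Z\setminus\{0\}$, put $u=\ell\alpha$, and let $(N_i)_{i\in\mathbb N}$ be a sequence of natural numbers tending to infinity such that, for some $\varphi,\omega\in\mathbb R$, $$\Big\{\frac{N_i}{c_{N_i}(u)}\Big\}\to\varphi,\qquad \Big\{\frac{a_{N_i}(u)}{c_{N_i}(u)}\Big\}\to\omega,$$ and $$\frac{c_{N_i}(u)}{N_i}\to0,\qquad \limsup_{i\to\infty}\frac{N_i^2\,\|c_{N_i}(u)\,u\|}{c_{N_i}(u)}<\infty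 .$$ Then $\widetilde\rho_{N_i,\alpha}$ converges weakly to $\nu_{\omega,\varphi}$. -/

import Mathlib

open MeasureTheory Filter Topology

noncomputable section

namespace SkewSums

/-- `e(x) = exp(2πix)`. -/
def e (x : ℝ) : ℂ := Complex.exp (2 * Real.pi * Complex.I * (x : ℂ))

/-! ### Skew translations of the torus and their Birkhoff sums -/

/-- The two-dimensional torus `ℝ² / ℤ²`. -/
abbrev Torus2 : Type := UnitAddCircle × UnitAddCircle

/-- The skew translation `(p, q) ↦ (p + α, q + p)`. -/
def skew (α : ℝ) (z : Torus2) : Torus2 := (z.1 + (α : UnitAddCircle), z.2 + z.1)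

/-- The harmonic `ψ_{k,ℓ}(p, q) = e(kp + ℓq)`. -/
def harmonic (k l : ℤ) (z : Torus2) : ℂ :=
  (AddCircle.toCircle (k • z.1 + l • z.2) : ℂ)

/-- The Birkhoff sum `∑_{n=1}^N ψ_{k,ℓ}(Λ_α^n (p, q))`. -/
def birkhoff (N : ℕ) (α : ℝ) (k l : ℤ) (z : Torus2) : ℂ :=
  ∑ n ∈ Finset.Icc 1 N, harmonic k l ((skew α)^[n] z)

/-! ### The arithmetic data attached to `u` and `N` -/

/-- The distance of a real number to the nearest integer. -/
def distInt (x : ℝ) : ℝ := |x - round x|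

/-- `c_N(u)`, the least `c ∈ {1, 2, …}` with `‖cu‖ ≤ 1/N`. -/
def cN (N : ℕ) (u : ℝ) : ℕ := sInf {c : ℕ | 0 < c ∧ distInt (c * u) ≤ (N : ℝ)⁻¹}

/-- `d_N(u)`, the integer `d` with `-1/2 ≤ c_N(u) u + d < 1/2`. -/
def dN (N : ℕ) (u : ℝ) : ℤ := -⌊(cN N u : ℝ) * u + 1 / 2⌋

/-- `a_N(u)`, the representative in `{0, …, c_N(u) - 1}` of the inverse of `d_N(u)`
modulo `c_N(u)`. -/
def aN (N : ℕ) (u : ℝ) : ℕ := ZMod.val ((dN N u : ZMod (cN N u))⁻¹)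

/-! ### The law of the renormalised Birkhoff sum -/

/-- The Birkhoff sum divided by `√(c_N(ℓα))`. -/
def renormSum (N : ℕ) (α : ℝ) (k l : ℤ) (z : Torus2) : ℂ :=
  birkhoff N α k l z / (Real.sqrt (cN N ((l : ℝ) * α)) : ℂ)

theorem continuous_renormSum (N : ℕ) (α : ℝ) (k l : ℤ) : Continuous (renormSum N α k l) := by
  have hs : Continuous (skew α) := by
    unfold skew
    fun_prop
  have hh : Continuous (harmonic k l) := by
    unfold harmonic
    exact continuous_subtype_val.comp (AddCircle.continuous_toCircle.comp (by fun_prop))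
  unfold renormSum birkhoff
  exact (continuous_finsetSum _ fun n _ => hh.comp (hs.iterate n)).div_const _

/-- The uniform law (Lebesgue measure) on the torus. -/
def uniformTorus2 : ProbabilityMeasure Torus2 :=
  ⟨volume, by
    have : IsProbabilityMeasure (volume : Measure UnitAddCircle) := ⟨by simp⟩
    infer_instance⟩

/-- The law of the renormalised Birkhoff sum, for `(p, q)` uniformly distributed. -/
def rhoTilde (N : ℕ) (α : ℝ) (k l : ℤ) : ProbabilityMeasure ℂ :=
  uniformTorus2.map (continuous_renormSum N α k l).measurable.aemeasurable

/-! ### The limit random variable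

The torus `𝕋^d` is represented by the unit cube `[0,1)^d`. -/

/-- The uniform law on `[0,1)`. -/
def unif : Measure ℝ := volume.restrict (Set.Ico 0 1)

instance : IsProbabilityMeasure unif := ⟨by simp [unif]⟩

/-- The uniform law of `(t', x, y)`. -/
def unif3 : Measure (ℝ × ℝ × ℝ) := unif.prod (unif.prod unif)

instance : IsProbabilityMeasure unif3 := by unfold unif3; infer_instance

/-- The `n`-th term of the random series, at the point `(t', x, y)`. -/
def seriesTerm (ω φ : ℝ) (n : ℤ) (z : ℝ × ℝ × ℝ) : ℂ :=
  (1 + e (z.1 - n * φ)) / ((n : ℂ) - (z.2.2 : ℂ)) *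
    e (1 / 2 * ((n : ℝ) - z.2.2) ^ 2 * ω + n * z.2.1)

/-- `Z` is the sum over `n ∈ ℤ` of the random series: the finite partial sums over finite sets
`s ⊂ ℤ` converge to `Z` in probability, along the directed set of finite subsets of `ℤ`.
The terms are of size `1/|n|` only, so the series is not absolutely convergent. -/
def IsSeriesSum (ω φ : ℝ) (Z : ℝ × ℝ × ℝ → ℂ) : Prop :=
  Measurable Z ∧
    TendstoInMeasure unif3 (fun (s : Finset ℤ) z => ∑ n ∈ s, seriesTerm ω φ n z) atTop Z

theorem continuous_e : Continuous e := by
  unfold e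
  fun_prop

theorem norm_e (x : ℝ) : ‖e x‖ = 1 := by
  have h : (2 * Real.pi * Complex.I * (x : ℂ)) = ((2 * Real.pi * x : ℝ) : ℂ) * Complex.I := by
    push_cast
    ring
  rw [e, h, Complex.norm_exp_ofReal_mul_I]

theorem e_add (x y : ℝ) : e (x + y) = e x * e y := by
  rw [e, e, e, ← Complex.exp_add]
  congr 1
  push_cast
  ring

theorem conj_e (x : ℝ) : starRingEnd ℂ (e x) = e (-x) := by
  rw [e, e, ← Complex.exp_conj]
  congr 1
  simp [Complex.conj_ofNat]

theorem integral_e_int (m : ℤ) (hm : m ≠ 0) : ∫ x, e (m * x) ∂unif = 0 := by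
  rw [unif, integral_Ico_eq_integral_Ioo, ← integral_Ioc_eq_integral_Ioo,
    ← intervalIntegral.integral_of_le zero_le_one]
  have hc : (2 * Real.pi * Complex.I * (m : ℂ)) ≠ 0 := by
    have : (m : ℂ) ≠ 0 := by exact_mod_cast hm
    simp [Real.pi_ne_zero, this]
  have h := integral_exp_mul_complex (a := 0) (b := 1) hc
  have h1 : Complex.exp (2 * Real.pi * Complex.I * (m : ℂ)) = 1 := by
    rw [Complex.exp_eq_one_iff]
    exact ⟨m, by ring⟩
  have h2 : (fun x : ℝ => e (m * x)) =
      fun x : ℝ => Complex.exp (2 * Real.pi * Complex.I * (m : ℂ) * x) := by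
    funext x
    rw [e]
    congr 1
    push_cast
    ring
  rw [h2, h]
  simp [h1]

theorem measurable_seriesTerm (ω φ : ℝ) (n : ℤ) : Measurable (seriesTerm ω φ n) := by
  have he : Measurable e := continuous_e.measurable
  unfold seriesTerm
  refine Measurable.mul (Measurable.div ?_ ?_) ?_
  · exact measurable_const.add (he.comp (by fun_prop))
  · exact measurable_const.sub (Complex.measurable_ofReal.comp (by fun_prop))
  · exact he.comp (by fun_prop)

theorem ae_unif3_mem : ∀ᵐ z ∂unif3, z.2.2 ∈ Set.Ico (0 : ℝ) 1 := by
  have h : ∀ᵐ y ∂unif, y ∈ Set.Ico (0 : ℝ) 1 := by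
    rw [unif]
    exact ae_restrict_mem measurableSet_Ico
  have h1 : Measure.QuasiMeasurePreserving (fun z : ℝ × ℝ × ℝ => z.2.2) unif3 unif :=
    Measure.quasiMeasurePreserving_snd.comp Measure.quasiMeasurePreserving_snd
  exact h1.ae h

/-- The terms of the series without those of index `0` and `1`, which are not
square integrable. -/
def seriesTail (ω φ : ℝ) (n : ℤ) (z : ℝ × ℝ × ℝ) : ℂ :=
  if n = 0 ∨ n = 1 then 0 else seriesTerm ω φ n z

theorem measurable_seriesTail (ω φ : ℝ) (n : ℤ) : Measurable (seriesTail ω φ n) := by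
  unfold seriesTail
  split_ifs
  · exact measurable_const
  · exact measurable_seriesTerm ω φ n

theorem norm_seriesTail_le (ω φ : ℝ) (n : ℤ) :
    ∀ᵐ z ∂unif3, ‖seriesTail ω φ n z‖ ≤ 4 / |(n : ℝ)| := by
  filter_upwards [ae_unif3_mem] with z hz
  rw [seriesTail]
  split_ifs with h
  · simp only [norm_zero]
    positivity
  have h0 : n ≠ 0 := fun h' => h (Or.inl h')
  have h1 : n ≠ 1 := fun h' => h (Or.inr h')
  have hn : 0 < |(n : ℝ)| := by
    rw [abs_pos]
    exact_mod_cast h0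
  have key : |(n : ℝ)| / 2 ≤ |(n : ℝ) - z.2.2| := by
    rcases lt_or_gt_of_ne h0 with h2 | h2
    · have h3 : (n : ℝ) < 0 := by exact_mod_cast h2
      rw [abs_of_neg h3, abs_of_neg (by linarith [hz.1])]
      linarith [hz.1]
    · have h3 : (2 : ℝ) ≤ n := by exact_mod_cast (by omega : (2 : ℤ) ≤ n)
      rw [abs_of_pos (by linarith), abs_of_pos (by linarith [hz.2])]
      linarith [hz.2]
  have hd : ‖((n : ℂ) - (z.2.2 : ℂ))‖ = |(n : ℝ) - z.2.2| := by
    rw [← Real.norm_eq_abs, ← Complex.norm_real]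
    push_cast
    rfl
  rw [seriesTerm, norm_mul, norm_div, norm_e, mul_one, hd]
  have hnum : ‖1 + e (z.1 - n * φ)‖ ≤ 2 := by
    refine (norm_add_le _ _).trans ?_
    rw [norm_e, norm_one]
    norm_num
  calc ‖1 + e (z.1 - n * φ)‖ / |(n : ℝ) - z.2.2| ≤ 2 / (|(n : ℝ)| / 2) := by
        gcongr
    _ = 4 / |(n : ℝ)| := by
        field_simp
        norm_num

theorem memLp_seriesTail (ω φ : ℝ) (n : ℤ) : MemLp (seriesTail ω φ n) 2 unif3 :=
  MemLp.of_bound (measurable_seriesTail ω φ n).aestronglyMeasurable _ (norm_seriesTail_le ω φ n)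

theorem integral_seriesTail_mul (ω φ : ℝ) {m n : ℤ} (hmn : m ≠ n) :
    ∫ z, seriesTail ω φ n z * starRingEnd ℂ (seriesTail ω φ m z) ∂unif3 = 0 := by
  by_cases hm : m = 0 ∨ m = 1
  · simp [seriesTail, hm]
  by_cases hn : n = 0 ∨ n = 1
  · simp [seriesTail, hn]
  have hint : Integrable (fun z => seriesTail ω φ n z * starRingEnd ℂ (seriesTail ω φ m z)) unif3 :=
    MemLp.integrable_mul (p := 2) (q := 2) (memLp_seriesTail ω φ n) (memLp_seriesTail ω φ m).star
  rw [unif3] at hint ⊢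
  rw [integral_prod _ hint]
  refine integral_eq_zero_of_ae ?_
  filter_upwards [hint.prod_right_ae] with t ht
  rw [integral_prod_symm _ ht]
  refine integral_eq_zero_of_ae (ae_of_all _ fun y => ?_)
  have h : ∀ x : ℝ, seriesTail ω φ n (t, x, y) * starRingEnd ℂ (seriesTail ω φ m (t, x, y)) =
      ((1 + e (t - n * φ)) / ((n : ℂ) - (y : ℂ)) * e (1 / 2 * ((n : ℝ) - y) ^ 2 * ω) *
        (starRingEnd ℂ ((1 + e (t - m * φ)) / ((m : ℂ) - (y : ℂ))) *
          e (-(1 / 2 * ((m : ℝ) - y) ^ 2 * ω)))) * e ((n - m : ℤ) * x) := by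
    intro x
    have h1 : (((n - m : ℤ) : ℝ) * x) = n * x + -(m * x) := by
      push_cast
      ring
    simp only [seriesTail, hm, hn, if_false, seriesTerm]
    rw [map_mul, conj_e, neg_add, e_add, e_add, h1, e_add]
    ring
  simp only [h]
  rw [integral_const_mul, integral_e_int _ (sub_ne_zero.2 hmn.symm), mul_zero]
  rfl

theorem summable_seriesTail (ω φ : ℝ) :
    Summable (fun n : ℤ => (memLp_seriesTail ω φ n).toLp (seriesTail ω φ n)) := by
  set f : ℤ → Lp ℂ 2 unif3 := fun n => (memLp_seriesTail ω φ n).toLp (seriesTail ω φ n) with hf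
  have horth : Pairwise fun m n : ℤ => inner ℂ (f m) (f n) = 0 := by
    intro m n hmn
    rw [L2.inner_def, ← integral_seriesTail_mul ω φ hmn]
    refine integral_congr_ae ?_
    filter_upwards [(memLp_seriesTail ω φ n).coeFn_toLp, (memLp_seriesTail ω φ m).coeFn_toLp] with z h1 h2
    simp only [hf]
    rw [h1, h2]
    rfl
  have hV : OrthogonalFamily ℂ (fun n : ℤ => (Submodule.span ℂ {f n} : Submodule ℂ (Lp ℂ 2 unif3)))
      fun n => (Submodule.span ℂ {f n}).subtypeₗᵢ := by
    refine OrthogonalFamily.of_pairwise fun m n hmn => ?_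
    change Submodule.span ℂ {f m} ⟂ Submodule.span ℂ {f n}
    rw [Submodule.isOrtho_span]
    rintro a rfl b rfl
    exact horth hmn
  have hs := hV.summable_iff_norm_sq_summable
    (fun n => ⟨f n, Submodule.mem_span_singleton_self _⟩)
  refine hs.2 ?_
  have hb : Summable fun n : ℤ => 16 * (1 / (n : ℝ) ^ 2) :=
    (Real.summable_one_div_int_pow.2 one_lt_two).mul_left 16
  refine Summable.of_nonneg_of_le (fun n => by positivity) (fun n => ?_) hb
  have hle : ‖f n‖ ≤ 4 / |(n : ℝ)| := by
    refine (Lp.norm_le_of_ae_bound (C := 4 / |(n : ℝ)|) (by positivity) ?_).trans ?_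
    · filter_upwards [norm_seriesTail_le ω φ n, (memLp_seriesTail ω φ n).coeFn_toLp] with z h1 h2
      simp only [hf]
      rw [h2]
      exact h1
    · simp [measureUnivNNReal]
  calc ‖f n‖ ^ 2 ≤ (4 / |(n : ℝ)|) ^ 2 := by gcongr
    _ = 16 * (1 / (n : ℝ) ^ 2) := by
        rw [div_pow, sq_abs]
        ring

theorem exists_isSeriesSum (ω φ : ℝ) : ∃ Z, IsSeriesSum ω φ Z := by
  obtain ⟨g, hg⟩ := summable_seriesTail ω φ
  have hsum : TendstoInMeasure unif3
      (fun (s : Finset ℤ) => ((∑ n ∈ s, (memLp_seriesTail ω φ n).toLp (seriesTail ω φ n) :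
        Lp ℂ 2 unif3) : ℝ × ℝ × ℝ → ℂ)) atTop g := tendstoInMeasure_of_tendsto_Lp hg
  obtain ⟨g', hg'm, hg'⟩ := (Lp.aestronglyMeasurable g).aemeasurable
  refine ⟨fun z => seriesTerm ω φ 0 z + seriesTerm ω φ 1 z + g' z,
    ((measurable_seriesTerm ω φ 0).add (measurable_seriesTerm ω φ 1)).add hg'm, ?_⟩
  have h2 : TendstoInMeasure unif3 (fun (s : Finset ℤ) z => ∑ n ∈ s, seriesTail ω φ n z) atTop g' := by
    refine hsum.congr (fun s => ?_) hg'
    have hall : ∀ᵐ z ∂unif3, ∀ n : ℤ,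
        ((memLp_seriesTail ω φ n).toLp (seriesTail ω φ n) : ℝ × ℝ × ℝ → ℂ) z = seriesTail ω φ n z :=
      ae_all_iff.2 fun n => (memLp_seriesTail ω φ n).coeFn_toLp
    filter_upwards [hall, Lp.coeFn_finsetSum s (fun n => (memLp_seriesTail ω φ n).toLp (seriesTail ω φ n))]
      with z hz hz2
    rw [hz2]
    simp [hz]
  intro ε hε
  refine (h2 ε hε).congr' ?_
  filter_upwards [eventually_ge_atTop ({0, 1} : Finset ℤ)] with s hs
  have key : ∀ z, ∑ n ∈ s, seriesTerm ω φ n z =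
      seriesTerm ω φ 0 z + seriesTerm ω φ 1 z + ∑ n ∈ s, seriesTail ω φ n z := by
    intro z
    rw [← Finset.sum_sdiff hs, ← Finset.sum_sdiff hs (f := fun n => seriesTail ω φ n z)]
    have h3 : ∑ n ∈ s \ {0, 1}, seriesTerm ω φ n z = ∑ n ∈ s \ {0, 1}, seriesTail ω φ n z := by
      refine Finset.sum_congr rfl fun n hn => ?_
      have : ¬(n = 0 ∨ n = 1) := by
        have := (Finset.mem_sdiff.1 hn).2
        simpa using this
      simp [seriesTail, this]
    rw [h3]
    simp [seriesTail]
    ring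
  simp only [key, edist_add_left]

/-- The sum of the random series, a random variable in `(t', x, y)`; any two sums agree almost
surely. -/
def seriesSum (ω φ : ℝ) : ℝ × ℝ × ℝ → ℂ := Classical.choose (exists_isSeriesSum ω φ)

theorem seriesSum_spec (ω φ : ℝ) : IsSeriesSum ω φ (seriesSum ω φ) :=
  Classical.choose_spec (exists_isSeriesSum ω φ)

/-- Uniqueness of the sum up to null sets: the law of `Y` below does not depend on the choice. -/
theorem IsSeriesSum.ae_eq {ω φ : ℝ} {Z Z' : ℝ × ℝ × ℝ → ℂ} (h : IsSeriesSum ω φ Z)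
    (h' : IsSeriesSum ω φ Z') : Z =ᵐ[unif3] Z' :=
  tendstoInMeasure_ae_unique h.2 h'.2

/-- The uniform law of `(t, (t', x, y))` on the unit cube `[0,1)⁴`. -/
def unif4 : ProbabilityMeasure (ℝ × ℝ × ℝ × ℝ) := ⟨unif.prod unif3, inferInstance⟩

/-- The random variable `Y_{ω,φ} = (e(t) / 2π) · |∑_{n ∈ ℤ} …|`. -/
def Y (ω φ : ℝ) (w : ℝ × ℝ × ℝ × ℝ) : ℂ :=
  e w.1 / (2 * Real.pi) * (‖seriesSum ω φ w.2‖ : ℂ)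

theorem measurable_Y (ω φ : ℝ) : Measurable (Y ω φ) := by
  have h := (seriesSum_spec ω φ).1
  have he : Measurable e := continuous_e.measurable
  unfold Y
  exact ((he.comp measurable_fst).div_const _).mul
    (Complex.measurable_ofReal.comp (h.comp measurable_snd).norm)

/-- The law `ν_{ω,φ}` of `Y_{ω,φ}`. -/
def nu (ω φ : ℝ) : ProbabilityMeasure ℂ := unif4.map (measurable_Y ω φ).aemeasurable

end SkewSums

end

noncomputable section

namespace SkewSums

/-!
Since `q` is uniform and `ℓ ≠ 0`, the law of the Birkhoff sum is that of the quadratic sum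
`∑_{n=1}^N e(np + n(n-1)u/2)`, `p` uniform, times an independent uniform phase. Both laws are thus
rotation invariant, and only the law of the modulus has to converge.

Write `u = -d/c + δ`, where `N²|δ|` is bounded by hypothesis. Up to a fixed translation,
`p = -(db + y)/c` with `b` uniform modulo `c` and `y` uniform in `[0,1)`, and the modulus of the
quadratic sum at `p` is that of the sum of `e(-dn(n-c)/(2c))`, times slowly varying factors, over
the window `b + 1, …, b + N`. For fixed `y`, modulate the step function of `x ∈ [0,1)` that takes
the value of this window sum, divided by `√c`, on the arc `[b/c, (b+1)/c)`. Its `j`-th Fourier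
coefficient is a normalised Gauss sum, which is a constant phase times a linear one times
`e(aj²/(2c))`, times a sum of slowly varying phases divided by `j - y`. Summation by parts leaves
only the boundary terms of the latter, as `c/N → 0`, and these are proportional to
`1 + e(t' - jN/c)` with `t' = Ny/c + const`. Completing the square gives the terms of the random
series at `ω = a/c`, `φ = N/c`. Since `N/c → ∞`, the phase `t'` becomes uniform and independent of
`y` in the limit. By Parseval, the Fourier tails are small in mean square uniformly in `N`, so
truncation to finitely many `j` commutes with the limit.
-/

attribute [fun_prop] continuous_e

theorem e_zero : e 0 = 1 := by simp [e]

theorem e_eq_one_iff {x : ℝ} : e x = 1 ↔ ∃ m : ℤ, x = m := by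
  rw [e, Complex.exp_eq_one_iff]
  refine exists_congr fun m => ?_
  rw [mul_comm, mul_left_inj' Complex.two_pi_I_ne_zero]
  norm_cast

theorem e_int (m : ℤ) : e m = 1 := e_eq_one_iff.2 ⟨m, rfl⟩

theorem e_add_int (x : ℝ) (m : ℤ) : e (x + m) = e x := by
  rw [e_add, e_int, mul_one]

theorem e_periodic : Function.Periodic e 1 := fun x => by simpa using e_add_int x 1

theorem e_eq_of_sub_eq_int {x y : ℝ} (m : ℤ) (h : x - y = m) : e x = e y := by
  rw [← e_add_int y m, ← h, add_sub_cancel]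

theorem e_neg_mul (x : ℝ) : e (-x) * e x = 1 := by
  rw [← e_add, neg_add_cancel, e_zero]

theorem e_pow (x : ℝ) (n : ℕ) : e x ^ n = e (n * x) := by
  rw [e, e, ← Complex.exp_nat_mul]
  congr 1
  push_cast
  ring

theorem norm_e_sub_one_le (x : ℝ) : ‖e x - 1‖ ≤ 2 * Real.pi * |x| := by
  have h := Real.norm_exp_I_mul_ofReal_sub_one_le (x := 2 * Real.pi * x)
  have hx : e x = Complex.exp (Complex.I * ((2 * Real.pi * x : ℝ) : ℂ)) := by
    rw [e]
    congr 1
    push_cast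
    ring
  rwa [Real.norm_eq_abs, abs_mul, abs_of_pos Real.two_pi_pos, ← hx] at h

theorem toCircle_coe_eq (x : ℝ) : (AddCircle.toCircle (x : UnitAddCircle) : ℂ) = e x := by
  rw [AddCircle.toCircle_apply_mk, Circle.coe_exp, e]
  congr 1
  push_cast
  ring

theorem e_mul_eq_circleMap (t r : ℝ) : e t * r = circleMap 0 r (2 * Real.pi * t) := by
  rw [circleMap, zero_add, mul_comm, e]
  congr 2
  push_cast
  ring

/-! ### The uniform law on the unit interval -/

theorem ae_unif_mem_Ioo : ∀ᵐ y ∂unif, y ∈ Set.Ioo (0 : ℝ) 1 := by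
  rw [unif, ← restrict_Ioo_eq_restrict_Ico]
  exact ae_restrict_mem measurableSet_Ioo

theorem integrable_unif_of_continuous {E : Type*} [NormedAddCommGroup E] {f : ℝ → E}
    (hf : Continuous f) : Integrable f unif :=
  hf.integrableOn_Icc.mono_set Set.Ico_subset_Icc_self

section UniformLaw

variable {E : Type*} [NormedAddCommGroup E] [NormedSpace ℝ E]

theorem integral_unif_eq (f : ℝ → E) : ∫ x, f x ∂unif = ∫ x in (0 : ℝ)..1, f x := by
  rw [unif, restrict_Ico_eq_restrict_Ioc, ← intervalIntegral.integral_of_le zero_le_one]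

theorem integral_circle_eq (f : UnitAddCircle → E) : ∫ x, f x = ∫ x : ℝ, f x ∂unif := by
  rw [integral_unif_eq, ← UnitAddCircle.intervalIntegral_preimage 0 f, zero_add]

theorem integral_unif_add_right {f : ℝ → E} (hf : Function.Periodic f 1) (r : ℝ) :
    ∫ x, f (x + r) ∂unif = ∫ x, f x ∂unif := by
  rw [integral_unif_eq, integral_unif_eq, intervalIntegral.integral_comp_add_right, zero_add,
    add_comm 1 r, hf.intervalIntegral_add_eq r 0, zero_add]

theorem circleAverage_eq_integral_unif (F : ℂ → E) (r : ℝ) :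
    Real.circleAverage F 0 r = ∫ t, F (e t * r) ∂unif := by
  simp only [e_mul_eq_circleMap]
  rw [integral_unif_eq, intervalIntegral.integral_comp_mul_left
    (fun θ => F (circleMap 0 r θ)) Real.two_pi_pos.ne', mul_zero, mul_one,
    Real.circleAverage_def]

theorem circleAverage_norm_eq_integral_toCircle (F : ℂ → E) (ζ : ℂ) :
    Real.circleAverage F 0 ‖ζ‖ = ∫ q : UnitAddCircle, F (AddCircle.toCircle q * ζ) := by
  have hζ : ζ = e (ζ.arg / (2 * Real.pi)) * ‖ζ‖ := by
    rw [e_mul_eq_circleMap, mul_div_cancel₀ _ Real.two_pi_pos.ne', circleMap, zero_add,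
      Complex.norm_mul_exp_arg_mul_I]
  have hper : Function.Periodic (fun t => F (e t * ‖ζ‖)) 1 := fun t => by
    simp only [e_periodic t]
  rw [circleAverage_eq_integral_unif, integral_circle_eq,
    ← integral_unif_add_right hper (ζ.arg / (2 * Real.pi))]
  simp only [toCircle_coe_eq, e_add, mul_assoc, ← hζ]

end UniformLaw

theorem integrable_comp_of_bounded {X Y : Type*} [MeasurableSpace X] {μ : Measure X}
    [IsFiniteMeasure μ] [TopologicalSpace Y] [MeasurableSpace Y] [BorelSpace Y]
    {F : Y → ℝ} (hF : Continuous F) {K : ℝ} (hK : ∀ ζ, |F ζ| ≤ K) {f : X → Y}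
    (hf : Measurable f) : Integrable (fun x => F (f x)) μ :=
  Integrable.of_bound (hF.measurable.comp hf).aestronglyMeasurable K (ae_of_all _ fun _ => hK _)

theorem norm_integral_le_of_ae_bound {X E : Type*} [MeasurableSpace X] {μ : Measure X}
    [IsProbabilityMeasure μ] [NormedAddCommGroup E] [NormedSpace ℝ E] {f : X → E} {B : ℝ}
    (hf : ∀ᵐ x ∂μ, ‖f x‖ ≤ B) : ‖∫ x, f x ∂μ‖ ≤ B := by
  simpa using norm_integral_le_of_norm_le_const hf

theorem abs_circleAverage_le {F : ℂ → ℝ} {K : ℝ} (hK : ∀ ζ, |F ζ| ≤ K) (r : ℝ) :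
    |Real.circleAverage F 0 r| ≤ K := by
  rw [circleAverage_eq_integral_unif, ← Real.norm_eq_abs]
  exact norm_integral_le_of_ae_bound (ae_of_all _ fun t => hK (e t * r))

theorem lipschitzWith_circleAverage {F : ℂ → ℝ} {L : NNReal} (hF : LipschitzWith L F) :
    LipschitzWith L (Real.circleAverage F 0) := by
  refine LipschitzWith.of_dist_le_mul fun r s => ?_
  have hint : ∀ r : ℝ, Integrable (fun t => F (e t * r)) unif := fun r =>
    integrable_unif_of_continuous (hF.continuous.comp (by fun_prop))
  rw [circleAverage_eq_integral_unif, circleAverage_eq_integral_unif, dist_eq_norm,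
    ← integral_sub (hint r) (hint s)]
  refine norm_integral_le_of_ae_bound (ae_of_all _ fun t => ?_)
  calc ‖F (e t * r) - F (e t * s)‖ ≤ L * dist (e t * r) (e t * s) := hF.dist_le_mul _ _
    _ = L * dist r s := by
      rw [dist_eq_norm, ← mul_sub, norm_mul, norm_e, one_mul, ← Complex.ofReal_sub,
        Complex.norm_real, dist_eq_norm]

theorem integral_nu {F : ℂ → ℝ} (hF : Continuous F) {K : ℝ} (hK : ∀ ζ, |F ζ| ≤ K) (ω φ : ℝ) :
    ∫ ζ, F ζ ∂(nu ω φ : Measure ℂ) =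
      ∫ z, Real.circleAverage F 0 ‖seriesSum ω φ z / (2 * Real.pi)‖ ∂unif3 := by
  have hY : ∀ t z, Y ω φ (t, z) = e t * (‖seriesSum ω φ z / (2 * Real.pi)‖ : ℝ) := fun t z => by
    have hpi : ‖(2 * Real.pi : ℂ)‖ = 2 * Real.pi := by simp [abs_of_pos Real.pi_pos]
    rw [Y, norm_div, hpi, Complex.ofReal_div]
    push_cast
    ring
  rw [nu, ProbabilityMeasure.toMeasure_map, integral_map (measurable_Y ω φ).aemeasurable
      hF.aestronglyMeasurable]
  change ∫ w, F (Y ω φ w) ∂(unif.prod unif3) = _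
  rw [integral_prod_symm _ (integrable_comp_of_bounded hF hK (measurable_Y ω φ))]
  simp only [hY, circleAverage_eq_integral_unif]

/-! ### Reduction to a quadratic exponential sum on the circle -/

theorem iterate_skew (α : ℝ) (n : ℕ) (z : Torus2) :
    (skew α)^[n] z = (z.1 + n • (α : UnitAddCircle),
      z.2 + n • z.1 + n.choose 2 • (α : UnitAddCircle)) := by
  induction n with
  | zero => simp
  | succ n ih =>
    rw [Function.iterate_succ_apply', ih, skew]
    ext1
    · simp only [succ_nsmul]
      abel
    · simp only [succ_nsmul, Nat.choose_succ_succ' n 1, Nat.choose_one_right, add_nsmul]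
      abel

/-- The quadratic exponential sum `∑_{n=1}^N e(np + n(n-1)u/2)`, as a function of `p` on the
circle; up to a unimodular factor the Birkhoff sums are its values. -/
def circleSum (N : ℕ) (u : ℝ) (p : UnitAddCircle) : ℂ :=
  ∑ n ∈ Finset.Icc 1 N, (AddCircle.toCircle (n • p + n.choose 2 • (u : UnitAddCircle)) : ℂ)

theorem continuous_coe_toCircle :
    Continuous fun p : UnitAddCircle => (AddCircle.toCircle p : ℂ) :=
  continuous_subtype_val.comp AddCircle.continuous_toCircle

theorem continuous_circleSum (N : ℕ) (u : ℝ) : Continuous (circleSum N u) :=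
  continuous_finsetSum _ fun _ _ => continuous_coe_toCircle.comp (by fun_prop)

theorem birkhoff_eq (N : ℕ) (α : ℝ) (k l : ℤ) (z : Torus2) :
    birkhoff N α k l z = AddCircle.toCircle (k • z.1 + l • z.2) *
      circleSum N (l * α) (l • z.1 + k • (α : UnitAddCircle)) := by
  rw [birkhoff, circleSum, Finset.mul_sum]
  refine Finset.sum_congr rfl fun n _ => ?_
  rw [harmonic, iterate_skew, ← Circle.coe_mul, ← AddCircle.toCircle_add, ← zsmul_eq_mul,
    AddCircle.coe_zsmul]
  congr 2
  simp only [smul_add, smul_comm k, smul_comm l]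
  abel

theorem integral_circle_zsmul_add {E : Type*} [NormedAddCommGroup E] [NormedSpace ℝ E] {l : ℤ}
    (hl : l ≠ 0) (b : UnitAddCircle) {f : UnitAddCircle → E} (hf : Continuous f) :
    ∫ q, f (l • q + b) = ∫ q, f q := by
  have hmp : MeasurePreserving (fun q : UnitAddCircle => l • q + b) :=
    (measurePreserving_add_right volume b).comp (Measure.measurePreserving_zsmul volume hl)
  exact hmp.hasLaw.integral_comp hf.aestronglyMeasurable

theorem integral_comp_renormSum_right {F : ℂ → ℝ} (hF : Continuous F) (N : ℕ) (α : ℝ) (k : ℤ)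
    {l : ℤ} (hl : l ≠ 0) (p : UnitAddCircle) :
    ∫ q : UnitAddCircle, F (renormSum N α k l (p, q)) = Real.circleAverage F 0
      ‖circleSum N (l * α) (l • p + k • (α : UnitAddCircle)) / √(cN N (l * α))‖ := by
  have hcont : ∀ ζ : ℂ, Continuous fun q : UnitAddCircle => F (AddCircle.toCircle q * ζ) :=
    fun ζ => hF.comp (continuous_coe_toCircle.mul continuous_const)
  rw [circleAverage_norm_eq_integral_toCircle, ← integral_circle_zsmul_add hl (k • p) (hcont _)]
  simp only [renormSum, birkhoff_eq, mul_div_assoc, add_comm]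

theorem integral_rhoTilde {F : ℂ → ℝ} (hF : Continuous F) {K : ℝ} (hK : ∀ ζ, |F ζ| ≤ K)
    (N : ℕ) (α : ℝ) (k : ℤ) {l : ℤ} (hl : l ≠ 0) :
    ∫ ζ, F ζ ∂(rhoTilde N α k l : Measure ℂ) = ∫ s : ℝ, Real.circleAverage F 0
      ‖circleSum N (l * α) (s : UnitAddCircle) / √(cN N (l * α))‖ ∂unif := by
  have hG : Continuous fun p : UnitAddCircle => Real.circleAverage F 0
      ‖circleSum N (l * α) p / √(cN N (l * α))‖ :=
    (Real.Continuous.circleAverage hF).comp ((continuous_circleSum N _).div_const _).norm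
  rw [rhoTilde, ProbabilityMeasure.toMeasure_map, integral_map
    (continuous_renormSum N α k l).measurable.aemeasurable hF.aestronglyMeasurable]
  change ∫ z : Torus2, F (renormSum N α k l z) = _
  rw [Measure.volume_eq_prod, integral_prod _ (integrable_comp_of_bounded hF hK
    (continuous_renormSum N α k l).measurable)]
  simp only [integral_comp_renormSum_right hF N α k hl]
  rw [integral_circle_zsmul_add hl (k • (α : UnitAddCircle)) hG, integral_circle_eq]

/-! ### Sums over residues -/

section Residues

variable {E : Type*} {c : ℕ} {h : ℤ → E}

theorem apply_eq_of_intCast_zmod_eq (hh : Function.Periodic h c) {m n : ℤ}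
    (hmn : (m : ZMod c) = n) : h m = h n := by
  obtain ⟨g, hg⟩ := (ZMod.intCast_eq_intCast_iff_dvd_sub m n c).1 hmn
  rw [← hh.int_mul g m]
  congr 1
  push_cast
  linear_combination -hg

variable [AddCommMonoid E] [NeZero c]

theorem sum_range_natCast_zmod (H : ZMod c → E) : ∑ b ∈ Finset.range c, H b = ∑ z, H z :=
  Finset.sum_nbij' (fun b => (b : ZMod c)) ZMod.val (fun _ _ => Finset.mem_univ _)
    (fun z _ => Finset.mem_range.2 z.val_lt)
    (fun _ hb => ZMod.val_cast_of_lt (Finset.mem_range.1 hb))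
    (fun z _ => ZMod.natCast_zmod_val z) (fun _ _ => rfl)

theorem sum_range_comp_affine (hh : Function.Periodic h c) {d : ℤ} (hd : IsUnit (d : ZMod c))
    (t : ℤ) : ∑ b ∈ Finset.range c, h (d * b + t) = ∑ b ∈ Finset.range c, h b := by
  obtain ⟨v, hv⟩ := hd
  have hcast : ∀ n : ℤ, h n = h ((n : ZMod c).cast : ℤ) := fun n =>
    apply_eq_of_intCast_zmod_eq hh (by simp)
  rw [Finset.sum_congr rfl fun (b : ℕ) _ => hcast (d * b + t),
    Finset.sum_congr rfl fun (b : ℕ) _ => hcast b]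
  push_cast
  rw [sum_range_natCast_zmod fun z : ZMod c => h ((d * z + t : ZMod c).cast : ℤ),
    sum_range_natCast_zmod fun z : ZMod c => h (z.cast : ℤ), ← hv]
  exact Equiv.sum_comp ((Units.mulLeft v).trans (Equiv.addRight (t : ZMod c)))
    fun z => h (z.cast : ℤ)

theorem e_div_eq_stdAddChar (m : ℤ) : e (m / c) = ZMod.stdAddChar (m : ZMod c) := by
  rw [ZMod.stdAddChar_coe, e]
  congr 1
  push_cast
  ring

theorem sum_range_e_div (n : ℤ) :
    ∑ b ∈ Finset.range c, e ((n * b : ℤ) / c) = if (n : ZMod c) = 0 then (c : ℂ) else 0 := by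
  rw [Finset.sum_congr rfl fun (b : ℕ) _ => e_div_eq_stdAddChar (c := c) (n * b)]
  push_cast
  rw [sum_range_natCast_zmod fun z : ZMod c => ZMod.stdAddChar ((n : ZMod c) * z)]
  simpa only [mul_comm, ZMod.card, Nat.cast_ite, Nat.cast_zero] using
    AddChar.sum_mulShift (n : ZMod c) (ZMod.isPrimitive_stdAddChar c)

end Residues

/-! ### Gauss sums -/

section GaussSum

/-- The quadratic phase `e(-dn(n-c)/(2c))`. The linear term `dn/2` makes it `c`-periodic in `n`,
whatever the parities of `c` and `d`. -/
def quad (c : ℕ) (d n : ℤ) : ℂ := e (-((d : ℝ) * n * (n - c)) / (2 * c))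

/-- The Gauss sum `∑_b quad(b) e(-jb/c)` over the residues `b` modulo `c`. -/
def gauss (c : ℕ) (d j : ℤ) : ℂ :=
  ∑ b ∈ Finset.range c, quad c d b * e ((-(j * b) : ℤ) / c)

theorem norm_quad (c : ℕ) (d n : ℤ) : ‖quad c d n‖ = 1 := norm_e _

theorem quad_zero (c : ℕ) (d : ℤ) : quad c d 0 = 1 := by simp [quad, e_zero]

theorem conj_quad_mul_quad (c : ℕ) (d n : ℤ) :
    starRingEnd ℂ (quad c d n) * quad c d n = 1 := by
  rw [quad, conj_e, e_neg_mul]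

theorem gauss_zero (c : ℕ) (d : ℤ) : gauss c d 0 = ∑ b ∈ Finset.range c, quad c d b := by
  simp [gauss, e_zero]

variable {c : ℕ} [NeZero c]

theorem quad_add (d m n : ℤ) :
    quad c d (m + n) = quad c d m * quad c d n * e ((-(d * m * n) : ℤ) / c) := by
  have hc : (c : ℝ) ≠ 0 := NeZero.ne _
  rw [quad, quad, quad, ← e_add, ← e_add]
  congr 1
  push_cast
  field_simp
  ring

theorem quad_periodic (d : ℤ) : Function.Periodic (quad c d) c := fun n => by
  have hc : (c : ℝ) ≠ 0 := NeZero.ne _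
  refine e_eq_of_sub_eq_int (-(d * n)) ?_
  push_cast
  field_simp
  ring

theorem gauss_zero_eq_sum_add (d t : ℤ) :
    gauss c d 0 = ∑ b ∈ Finset.range c, quad c d (b + t) := by
  simpa [gauss_zero] using
    (sum_range_comp_affine (quad_periodic (c := c) d) (d := 1) (by simp) t).symm

theorem gauss_periodic (d : ℤ) : Function.Periodic (gauss c d) c := fun j => by
  simp only [gauss, e_div_eq_stdAddChar]
  push_cast
  simp

theorem gauss_mul (d t : ℤ) :
    gauss c d (d * t) = starRingEnd ℂ (quad c d t) * gauss c d 0 := by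
  rw [gauss_zero_eq_sum_add d t, gauss, Finset.mul_sum]
  refine Finset.sum_congr rfl fun b _ => ?_
  rw [quad_add, mul_right_comm d t]
  linear_combination
    (-(quad c d b * e ((-(d * b * t) : ℤ) / c))) * conj_quad_mul_quad c d t

theorem conj_gauss_zero_mul_gauss_zero {d : ℤ} (hd : IsUnit (d : ZMod c)) :
    starRingEnd ℂ (gauss c d 0) * gauss c d 0 = c := by
  have hterm : ∀ b : ℕ, starRingEnd ℂ (quad c d b) * gauss c d 0 =
      ∑ n ∈ Finset.range c, quad c d n * e ((-(d * n) * b : ℤ) / c) := fun b => by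
    rw [← gauss_mul, gauss]
    exact Finset.sum_congr rfl fun n _ => by congr 4; ring
  have hzero : ∀ n ∈ Finset.range c, ((-(d * n) : ℤ) : ZMod c) = 0 ↔ n = 0 := fun n hn => by
    push_cast
    rw [neg_eq_zero, hd.mul_right_eq_zero, ZMod.natCast_eq_zero_iff]
    exact ⟨fun h => Nat.eq_zero_of_dvd_of_lt h (Finset.mem_range.1 hn), fun h => h ▸ dvd_zero c⟩
  calc starRingEnd ℂ (gauss c d 0) * gauss c d 0
      = ∑ n ∈ Finset.range c, quad c d n *
          ∑ b ∈ Finset.range c, e ((-(d * n) * b : ℤ) / c) := by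
        nth_rewrite 1 [gauss_zero]
        simp only [map_sum, Finset.sum_mul, hterm, Finset.mul_sum]
        exact Finset.sum_comm
    _ = ∑ n ∈ Finset.range c, if n = 0 then (c : ℂ) else 0 :=
        Finset.sum_congr rfl fun n hn => by
          rw [sum_range_e_div, if_congr (hzero n hn) rfl rfl]
          split_ifs with h <;> simp [h, quad_zero]
    _ = c := by simp [NeZero.pos c]

theorem norm_gauss_zero {d : ℤ} (hd : IsUnit (d : ZMod c)) : ‖gauss c d 0‖ = √c := by
  have h := conj_gauss_zero_mul_gauss_zero hd
  rw [mul_comm, Complex.mul_conj, Complex.normSq_eq_norm_sq] at h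
  rw [eq_comm, Real.sqrt_eq_iff_eq_sq c.cast_nonneg (norm_nonneg _)]
  exact_mod_cast h.symm

theorem exists_gauss_eq {d a : ℤ} (ha : (d : ZMod c) * a = 1) :
    ∃ σ : ℝ, ∀ j : ℤ, gauss c d j = e (a * j ^ 2 / (2 * c) + j * σ) * gauss c d 0 := by
  have hc : (c : ℝ) ≠ 0 := NeZero.ne _
  obtain ⟨g, hg⟩ : (c : ℤ) ∣ d * a - 1 :=
    (ZMod.intCast_zmod_eq_zero_iff_dvd _ _).1 (by push_cast; rw [ha, sub_self])
  refine ⟨(a * g - d * a : ℤ) / 2, fun j => ?_⟩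
  have hj : gauss c d j = gauss c d (d * (a * j)) :=
    apply_eq_of_intCast_zmod_eq (gauss_periodic d) (by push_cast; rw [← mul_assoc, ha, one_mul])
  obtain ⟨r, hr⟩ := Int.even_mul_pred_self j
  have hr' : (j : ℝ) * (j - 1) = r + r := by exact_mod_cast hr
  have hg' : (d : ℝ) * a - 1 = c * g := by exact_mod_cast hg
  rw [hj, gauss_mul, quad, conj_e]
  congr 1
  refine e_eq_of_sub_eq_int (a * g * r) ?_
  push_cast
  field_simp
  linear_combination (a * g * c : ℝ) * hr' + (a * j ^ 2 : ℝ) * hg'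

end GaussSum

/-! ### Cutting the circle into arcs -/

theorem integral_unif_eq_sum {E : Type*} [NormedAddCommGroup E] [NormedSpace ℝ E] {g : ℝ → E}
    (hg : ∀ a b, IntervalIntegrable g volume a b) (c : ℕ) [NeZero c] :
    ∫ x, g x ∂unif = (c : ℝ)⁻¹ • ∑ b ∈ Finset.range c, ∫ v, g ((b + v) / c) ∂unif := by
  have hc : (c : ℝ) ≠ 0 := NeZero.ne _
  have harc : ∀ b : ℕ, ∫ v, g ((b + v) / c) ∂unif =
      (c : ℝ) • ∫ x in (b / c : ℝ)..((b + 1 : ℕ) / c : ℝ), g x := fun b => by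
    rw [integral_unif_eq, ← intervalIntegral.integral_comp_div _ hc]
    push_cast
    rw [intervalIntegral.integral_comp_add_left (fun x => g (x / c)), add_zero]
  simp only [harc]
  rw [← Finset.smul_sum, inv_smul_smul₀ hc,
    intervalIntegral.sum_integral_adjacent_intervals fun _ _ => hg _ _, integral_unif_eq]
  simp [hc]

theorem integral_unif_neg {E : Type*} [NormedAddCommGroup E] [NormedSpace ℝ E] {f : ℝ → E}
    (hf : Function.Periodic f 1) : ∫ x, f (-x) ∂unif = ∫ x, f x ∂unif := by
  simpa [integral_unif_eq] using hf.intervalIntegral_add_eq (-1) 0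

/-- The slowly varying quadratic phase `e(δ n(n-1)/2)`. -/
def slow (δ : ℝ) (n : ℕ) : ℂ := e (δ * (n * (n - 1) / 2))

/-- The quadratic exponential sum as a function of the linear frequency. -/
def quadSum (N c : ℕ) (d : ℤ) (δ s : ℝ) : ℂ :=
  ∑ n ∈ Finset.Icc 1 N, quad c d n * slow δ n * e (n * s)

/-- The quadratic exponential sum over the window `b + 1, …, b + N`. -/
def windowSum (N c : ℕ) (d : ℤ) (δ : ℝ) (b : ℤ) (y : ℝ) : ℂ :=
  ∑ n ∈ Finset.Icc 1 N, quad c d (n + b) * slow δ n * e (-(n * y) / c)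

/-- The normalised window sums as a step function of the window, modulated by the linear phase
`e(y {cx} / c)`, which makes the Fourier coefficients in `x` explicit. -/
def profile (N c : ℕ) (d : ℤ) (δ y x : ℝ) : ℂ :=
  e (y * Int.fract (c * x) / c) * (windowSum N c d δ ⌊c * x⌋ y / √c)

theorem norm_slow (δ : ℝ) (n : ℕ) : ‖slow δ n‖ = 1 := norm_e _

theorem quadSum_periodic (N c : ℕ) (d : ℤ) (δ : ℝ) : Function.Periodic (quadSum N c d δ) 1 :=
  fun s => Finset.sum_congr rfl fun n _ => by
    rw [mul_add, mul_one]
    exact congrArg _ (e_add_int _ n)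

@[fun_prop]
theorem continuous_quadSum (N c : ℕ) (d : ℤ) (δ : ℝ) : Continuous (quadSum N c d δ) := by
  unfold quadSum
  fun_prop

theorem norm_windowSum_le (N c : ℕ) (d : ℤ) (δ : ℝ) (b : ℤ) (y : ℝ) :
    ‖windowSum N c d δ b y‖ ≤ N := by
  refine (norm_sum_le _ _).trans ?_
  simp [norm_quad, norm_slow, norm_e]

theorem norm_profile (N c : ℕ) (d : ℤ) (δ y x : ℝ) :
    ‖profile N c d δ y x‖ = ‖windowSum N c d δ ⌊c * x⌋ y / √c‖ := by
  rw [profile, norm_mul, norm_e, one_mul]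

theorem norm_profile_le (N c : ℕ) (d : ℤ) (δ y x : ℝ) :
    ‖profile N c d δ y x‖ ≤ N / √c := by
  rw [norm_profile, norm_div, Complex.norm_of_nonneg (Real.sqrt_nonneg _)]
  gcongr
  exact norm_windowSum_le ..

theorem measurable_profile (N c : ℕ) (d : ℤ) (δ : ℝ) :
    Measurable (Function.uncurry (profile N c d δ)) := by
  have hfloor : Measurable fun z : ℝ × ℝ => ⌊(c : ℝ) * z.2⌋ :=
    Int.measurable_floor.comp (by fun_prop)
  have hquad : ∀ n : ℕ, Measurable fun z : ℝ × ℝ => quad c d (n + ⌊(c : ℝ) * z.2⌋) := fun n =>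
    (measurable_of_countable fun b : ℤ => quad c d (n + b)).comp hfloor
  unfold Function.uncurry profile windowSum
  fun_prop

@[fun_prop]
theorem measurable_profile_right (N c : ℕ) (d : ℤ) (δ y : ℝ) :
    Measurable (profile N c d δ y) :=
  (measurable_profile N c d δ).of_uncurry_left

section Arcs

variable (N : ℕ) {c : ℕ} [NeZero c] (d : ℤ) (δ : ℝ)

theorem floor_mul_add_div (b : ℤ) {v : ℝ} (hv : v ∈ Set.Ico (0 : ℝ) 1) :
    ⌊c * ((b + v) / c)⌋ = b := by
  rw [mul_div_cancel₀ _ (NeZero.ne (c : ℝ)), Int.floor_intCast_add, Int.floor_eq_zero_iff.2 hv,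
    add_zero]

theorem profile_div {y v : ℝ} (b : ℤ) (hv : v ∈ Set.Ico (0 : ℝ) 1) :
    profile N c d δ y ((b + v) / c) = e (y * v / c) * (windowSum N c d δ b y / √c) := by
  rw [profile, Int.fract, floor_mul_add_div b hv, mul_div_cancel₀ _ (NeZero.ne (c : ℝ)),
    add_sub_cancel_left]

theorem circleSum_coe (s : ℝ) :
    circleSum N (-d / c + δ) (s : UnitAddCircle) =
      quadSum N c d δ (s + -((d : ℝ) * (c - 1) / (2 * c))) := by
  have hc : (c : ℝ) ≠ 0 := NeZero.ne _
  refine Finset.sum_congr rfl fun n _ => ?_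
  have hcoe : n • (s : UnitAddCircle) + n.choose 2 • ((-d / c + δ : ℝ) : UnitAddCircle) =
      ((n * s + n * (n - 1) / 2 * (-d / c + δ) : ℝ) : UnitAddCircle) := by
    rw [← Nat.cast_choose_two, ← nsmul_eq_mul, ← nsmul_eq_mul]
    rfl
  rw [hcoe, toCircle_coe_eq, quad, slow, ← e_add, ← e_add]
  congr 1
  push_cast
  field_simp
  ring

theorem windowSum_eq_quad_mul_quadSum (b : ℤ) (y : ℝ) :
    windowSum N c d δ b y = quad c d b * quadSum N c d δ (-(((d * b : ℤ) + y) / c)) := by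
  rw [windowSum, quadSum, Finset.mul_sum]
  refine Finset.sum_congr rfl fun n _ => ?_
  have hphase : e (n * -(((d * b : ℤ) + y) / c)) =
      e ((-(d * n * b) : ℤ) / c) * e (-(n * y) / c) := by
    rw [← e_add]
    congr 1
    push_cast
    ring
  rw [hphase, quad_add]
  ring

theorem sum_range_comp_norm_windowSum (G : ℝ → ℝ) {d : ℤ} (hd : IsUnit (d : ZMod c)) (y : ℝ) :
    ∑ b ∈ Finset.range c, G ‖windowSum N c d δ b y / √c‖ =
      ∑ b ∈ Finset.range c, G ‖quadSum N c d δ (-((b + y) / c)) / √c‖ := by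
  have hper : Function.Periodic
      (fun m : ℤ => G ‖quadSum N c d δ (-((m + y) / c)) / √c‖) c := fun m => by
    have harg : -(((m + c : ℤ) + y) / c : ℝ) = -((m + y) / c) - 1 := by
      have hc : (c : ℝ) ≠ 0 := NeZero.ne _
      push_cast
      field_simp
      ring
    simp only [harg, (quadSum_periodic N c d δ).sub_eq]
  simpa [windowSum_eq_quad_mul_quadSum, norm_quad] using sum_range_comp_affine hper hd 0

variable {G : ℝ → ℝ} (hG : Continuous G) {K : ℝ} (hK : ∀ r, |G r| ≤ K)
include hG hK

theorem integral_comp_norm_profile (y : ℝ) :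
    ∫ x, G ‖profile N c d δ y x‖ ∂unif =
      (c : ℝ)⁻¹ • ∑ b ∈ Finset.range c, G ‖windowSum N c d δ b y / √c‖ := by
  have hmeas : Measurable fun x => G ‖profile N c d δ y x‖ := hG.measurable.comp (by fun_prop)
  rw [integral_unif_eq_sum (fun a b => intervalIntegrable_iff.2
    (Measure.integrableOn_of_bounded (by simp) hmeas.aestronglyMeasurable
      (ae_of_all _ fun x => hK _))) c]
  congr 1
  refine Finset.sum_congr rfl fun b _ => ?_
  have harc : ∀ᵐ v ∂unif, G ‖profile N c d δ y ((b + v) / c)‖ =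
      G ‖windowSum N c d δ b y / √c‖ := by
    filter_upwards [ae_unif_mem_Ioo] with v hv
    have hfloor := floor_mul_add_div (c := c) b (Set.Ioo_subset_Ico_self hv)
    rw [Int.cast_natCast] at hfloor
    rw [norm_profile, hfloor]
  simp [integral_congr_ae harc]

theorem integral_circleSum_eq {d : ℤ} (hd : IsUnit (d : ZMod c)) :
    ∫ s : ℝ, G ‖circleSum N (-d / c + δ) (s : UnitAddCircle) / √c‖ ∂unif =
      ∫ y, ∫ x, G ‖profile N c d δ y x‖ ∂unif ∂unif := by
  set f : ℝ → ℝ := fun s => G ‖quadSum N c d δ s / √c‖ with hf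
  have hcont : Continuous f := hG.comp (by fun_prop)
  have hper : Function.Periodic f 1 := fun s => by simp only [hf, quadSum_periodic N c d δ s]
  simp only [circleSum_coe, integral_comp_norm_profile N d δ hG hK,
    sum_range_comp_norm_windowSum N δ G hd]
  calc ∫ s, f (s + -((d : ℝ) * (c - 1) / (2 * c))) ∂unif = ∫ s, f (-s) ∂unif := by
        rw [integral_unif_add_right hper, integral_unif_neg hper]
    _ = (c : ℝ)⁻¹ • ∑ b ∈ Finset.range c, ∫ y, f (-((b + y) / c)) ∂unif :=
        integral_unif_eq_sum
          (fun _ _ => (hcont.comp continuous_neg).intervalIntegrable _ _) c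
    _ = ∫ y, (c : ℝ)⁻¹ • ∑ b ∈ Finset.range c, f (-((b + y) / c)) ∂unif := by
        rw [integral_smul, integral_finsetSum _ fun b _ =>
          integrable_unif_of_continuous (by fun_prop)]

end Arcs

/-! ### Summation by parts -/

theorem one_sub_e_mul_sum_Icc (k : ℕ → ℂ) (w : ℝ) (N : ℕ) :
    (1 - e (-w)) * ∑ n ∈ Finset.Icc 1 N, k n * e (n * w) =
      k N * e (N * w) - k 0 - ∑ n ∈ Finset.range N, (k (n + 1) - k n) * e (n * w) := by
  induction N with
  | zero => simp [e_zero]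
  | succ N ih =>
    have hshift : e (-w) * e ((N + 1 : ℕ) * w) = e (N * w) := by
      rw [← e_add]
      congr 1
      push_cast
      ring
    rw [Finset.sum_Icc_succ_top (by omega), mul_add, ih, Finset.sum_range_succ]
    linear_combination -k (N + 1) * hshift

theorem e_sub_one_mul_sum_range (k : ℕ → ℂ) (w : ℝ) (N : ℕ) :
    (e w - 1) * ∑ n ∈ Finset.range N, k n * e (n * w) =
      k N * e (N * w) - k 0 - e w * ∑ n ∈ Finset.range N, (k (n + 1) - k n) * e (n * w) := by
  have hshift : ∀ n : ℕ, e ((n + 1 : ℕ) * w) = e w * e (n * w) := fun n => by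
    rw [← e_add]
    congr 1
    push_cast
    ring
  have htel := Finset.sum_range_sub (fun n => k n * e (n * w)) N
  simp only [hshift, Nat.cast_zero, zero_mul, e_zero, mul_one] at htel
  rw [← htel, Finset.mul_sum, Finset.mul_sum, ← Finset.sum_sub_distrib]
  exact Finset.sum_congr rfl fun n _ => by ring

theorem norm_sum_range_mul_e_le {k : ℕ → ℂ} {V : ℝ} {N : ℕ} (hV : ∀ n < N, ‖k n‖ ≤ V) (w : ℝ) :
    ‖∑ n ∈ Finset.range N, k n * e (n * w)‖ ≤ N * V := by
  simpa using norm_sum_le_of_le (Finset.range N) (f := fun n => k n * e (n * w)) (n := fun _ => V)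
    fun n hn => by simpa [norm_e] using hV n (Finset.mem_range.1 hn)

theorem slow_zero (δ : ℝ) : slow δ 0 = 1 := by simp [slow, e_zero]

theorem slow_succ_sub (δ : ℝ) (n : ℕ) :
    slow δ (n + 1) - slow δ n = slow δ n * (e (δ * n) - 1) := by
  rw [mul_sub, mul_one, slow, slow, ← e_add]
  congr 2
  push_cast
  ring

theorem norm_e_mul_natCast_sub_one_le (δ : ℝ) {n N : ℕ} (h : n ≤ N) :
    ‖e (δ * n) - 1‖ ≤ 2 * Real.pi * (|δ| * N) := by
  refine (norm_e_sub_one_le _).trans ?_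
  rw [abs_mul, Nat.abs_cast]
  gcongr

theorem norm_slow_succ_sub_le (δ : ℝ) {n N : ℕ} (h : n ≤ N) :
    ‖slow δ (n + 1) - slow δ n‖ ≤ 2 * Real.pi * (|δ| * N) := by
  rw [slow_succ_sub, norm_mul, norm_slow, one_mul]
  exact norm_e_mul_natCast_sub_one_le δ h

theorem norm_slow_second_difference_le (δ : ℝ) {n N : ℕ} (h : n < N) :
    ‖(slow δ (n + 1 + 1) - slow δ (n + 1)) - (slow δ (n + 1) - slow δ n)‖ ≤
      (2 * Real.pi * (|δ| * N)) ^ 2 + 2 * Real.pi * |δ| := by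
  have hsplit : (slow δ (n + 1 + 1) - slow δ (n + 1)) - (slow δ (n + 1) - slow δ n) =
      (slow δ (n + 1) - slow δ n) * (e (δ * (n + 1 : ℕ)) - 1) +
        slow δ n * e (δ * n) * (e δ - 1) := by
    have hmul : e (δ * (n + 1 : ℕ)) = e (δ * n) * e δ := by
      rw [← e_add]
      congr 1
      push_cast
      ring
    rw [slow_succ_sub δ (n + 1), hmul]
    linear_combination -slow_succ_sub δ n
  rw [hsplit, sq]
  refine norm_add_le_of_le ?_ ?_
  · rw [norm_mul]
    gcongr
    exacts [norm_slow_succ_sub_le δ h.le, norm_e_mul_natCast_sub_one_le δ h]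
  · rw [norm_mul, norm_mul, norm_slow, norm_e, one_mul, one_mul]
    exact norm_e_sub_one_le δ

section SlowSum

variable {δ C : ℝ} {N : ℕ} (hC : (N : ℝ) ^ 2 * |δ| ≤ C) (w : ℝ)
include hC

theorem norm_slow_sum_le :
    ‖(1 - e (-w)) * ∑ n ∈ Finset.Icc 1 N, slow δ n * e (n * w)‖ ≤ 2 + 2 * Real.pi * C := by
  rw [one_sub_e_mul_sum_Icc]
  calc ‖slow δ N * e (N * w) - slow δ 0 -
        ∑ n ∈ Finset.range N, (slow δ (n + 1) - slow δ n) * e (n * w)‖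
      ≤ 1 + 1 + N * (2 * Real.pi * (|δ| * N)) := by
        refine norm_sub_le_of_le (norm_sub_le_of_le ?_ ?_)
          (norm_sum_range_mul_e_le (fun n hn => norm_slow_succ_sub_le δ hn.le) w)
        · rw [norm_mul, norm_slow, norm_e, one_mul]
        · rw [norm_slow]
    _ = 2 + 2 * Real.pi * (N ^ 2 * |δ|) := by ring
    _ ≤ 2 + 2 * Real.pi * C := by gcongr

theorem norm_slow_sum_sub_le :
    N * (‖e w - 1‖ * ‖(1 - e (-w)) * ∑ n ∈ Finset.Icc 1 N, slow δ n * e (n * w) -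
      (slow δ N * e (N * w) - 1)‖) ≤ 4 * Real.pi * C + (2 * Real.pi * C) ^ 2 := by
  have hfirst : slow δ (0 + 1) - slow δ 0 = 0 := by simp [slow_succ_sub, e_zero]
  rw [one_sub_e_mul_sum_Icc, slow_zero, sub_sub_cancel_left, norm_neg, ← norm_mul,
    e_sub_one_mul_sum_range fun n => slow δ (n + 1) - slow δ n, hfirst, sub_zero]
  calc N * ‖(slow δ (N + 1) - slow δ N) * e (N * w) - e w * ∑ n ∈ Finset.range N,
        ((slow δ (n + 1 + 1) - slow δ (n + 1)) - (slow δ (n + 1) - slow δ n)) * e (n * w)‖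
      ≤ N * (2 * Real.pi * (|δ| * N) +
          N * ((2 * Real.pi * (|δ| * N)) ^ 2 + 2 * Real.pi * |δ|)) := by
        gcongr
        refine norm_sub_le_of_le ?_ ?_
        · rw [norm_mul, norm_e, mul_one]
          exact norm_slow_succ_sub_le δ le_rfl
        · rw [norm_mul, norm_e, one_mul]
          exact norm_sum_range_mul_e_le (fun n hn => norm_slow_second_difference_le δ hn) w
    _ = 4 * Real.pi * (N ^ 2 * |δ|) + (2 * Real.pi * (N ^ 2 * |δ|)) ^ 2 := by ring
    _ ≤ 4 * Real.pi * C + (2 * Real.pi * C) ^ 2 := by gcongr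

end SlowSum

theorem norm_e_mul_sub_one_le (c : ℕ) (x : ℝ) : ‖e (c * x) - 1‖ ≤ c * ‖e x - 1‖ := by
  rw [← e_pow, ← mul_geom_sum, norm_mul, mul_comm]
  gcongr
  refine (norm_sum_le _ _).trans ?_
  simp [norm_e]

/-! ### Fourier coefficients of the profile -/

/-- The `j`-th Fourier coefficient of `profile N c d δ y`, see `integral_e_mul_profile`. -/
def coef (N c : ℕ) (d : ℤ) (δ y : ℝ) (j : ℤ) : ℂ :=
  gauss c d j / √c * (((1 - e (-((j - y) / c))) *
    ∑ n ∈ Finset.Icc 1 N, slow δ n * e (n * ((j - y) / c))) /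
      (2 * Real.pi * Complex.I * (j - y : ℝ)))

/-- The Fourier sum of the profile over a finite set of frequencies. -/
def coefSum (N c : ℕ) (d : ℤ) (δ : ℝ) (s : Finset ℤ) (y x : ℝ) : ℂ :=
  ∑ j ∈ s, coef N c d δ y j * e (j * x)

theorem measurable_coefSum (N c : ℕ) (d : ℤ) (δ : ℝ) (s : Finset ℤ) :
    Measurable (Function.uncurry (coefSum N c d δ s)) := by
  unfold coefSum coef Function.uncurry
  fun_prop

theorem integral_e_neg_mul {w : ℝ} (hw : w ≠ 0) :
    ∫ v, e (-(w * v)) ∂unif = (1 - e (-w)) / (2 * Real.pi * Complex.I * w) := by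
  have he : ∀ v : ℝ, e (-(w * v)) = Complex.exp (-(2 * Real.pi * Complex.I * w) * v) := fun v => by
    rw [e]
    congr 1
    push_cast
    ring
  have hexp := integral_exp_mul_complex (a := 0) (b := 1)
    (c := -(2 * Real.pi * Complex.I * w)) (by simp [Real.pi_ne_zero, hw])
  simp only [← he, mul_one, mul_zero, neg_zero, e_zero] at hexp
  rw [integral_unif_eq, hexp, div_neg, ← neg_div, neg_sub]

/-- The main part of `coef`: the boundary terms of a summation by parts. -/
def boundaryCoef (N c : ℕ) (d : ℤ) (δ y : ℝ) (j : ℤ) : ℂ :=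
  gauss c d j / √c *
    ((slow δ N * e (N * ((j - y) / c)) - 1) / (2 * Real.pi * Complex.I * (j - y : ℝ)))

section Coefficients

variable (N : ℕ) {c : ℕ} [NeZero c] (d j : ℤ) (δ : ℝ) {y : ℝ}

theorem sum_e_mul_quad_add (n : ℤ) :
    ∑ b ∈ Finset.range c, e ((-(j * b) : ℤ) / c) * quad c d (n + b) =
      e (j * n / c) * gauss c d j := by
  have hper : Function.Periodic (fun m : ℤ => quad c d m * e ((-(j * m) : ℤ) / c)) c := fun m => by
    simp only [quad_periodic d m, e_div_eq_stdAddChar]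
    push_cast
    simp
  have hshift := sum_range_comp_affine hper (d := 1) (by simp) n
  rw [gauss, ← hshift, Finset.mul_sum]
  refine Finset.sum_congr rfl fun b _ => ?_
  have hphase : e ((-(j * b) : ℤ) / c) = e (j * n / c) * e ((-(j * (1 * b + n)) : ℤ) / c) := by
    rw [← e_add]
    congr 1
    push_cast
    ring
  rw [hphase, one_mul, add_comm n]
  ring

theorem sum_e_mul_windowSum (y : ℝ) :
    ∑ b ∈ Finset.range c, e ((-(j * b) : ℤ) / c) * windowSum N c d δ b y =
      gauss c d j * ∑ n ∈ Finset.Icc 1 N, slow δ n * e (n * ((j - y) / c)) := by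
  simp only [windowSum, Finset.mul_sum]
  rw [Finset.sum_comm]
  refine Finset.sum_congr rfl fun n _ => ?_
  have hphase : e (n * ((j - y) / c)) = e (j * n / c) * e (-(n * y) / c) := by
    rw [← e_add]
    congr 1
    ring
  have hgauss := sum_e_mul_quad_add (c := c) d j n
  rw [Int.cast_natCast] at hgauss
  simp only [← mul_assoc]
  rw [← Finset.sum_mul, ← Finset.sum_mul, hgauss, hphase]
  ring

theorem integral_e_mul_profile_arc (y : ℝ) (b : ℕ) :
    ∫ v, e (-(j * ((b + v) / c))) * profile N c d δ y ((b + v) / c) ∂unif =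
      e ((-(j * b) : ℤ) / c) * windowSum N c d δ b y / √c *
        ∫ v, e (-((j - y) / c * v)) ∂unif := by
  rw [← integral_const_mul]
  refine integral_congr_ae ?_
  filter_upwards [ae_unif_mem_Ioo] with v hv
  have hprofile := profile_div (y := y) N d δ (c := c) b (Set.Ioo_subset_Ico_self hv)
  have hphase : e (-(j * ((b + v) / c))) * e (y * v / c) =
      e ((-(j * b) : ℤ) / c) * e (-((j - y) / c * v)) := by
    rw [← e_add, ← e_add]
    congr 1
    push_cast
    ring
  rw [Int.cast_natCast] at hprofile
  rw [hprofile]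
  linear_combination (windowSum N c d δ b y / √c) * hphase

theorem integral_e_mul_profile (hy : (j : ℝ) - y ≠ 0) :
    ∫ x, e (-(j * x)) * profile N c d δ y x ∂unif = coef N c d δ y j := by
  have hc : (c : ℝ) ≠ 0 := NeZero.ne _
  have hc' : (c : ℂ) ≠ 0 := NeZero.ne _
  have hint : ∀ a b, IntervalIntegrable (fun x : ℝ => e (-(j * x)) * profile N c d δ y x)
      volume a b := fun a b => by
    rw [intervalIntegrable_iff]
    refine Measure.integrableOn_of_bounded (M := N / √c) (by simp)
      (Measurable.aestronglyMeasurable (by fun_prop)) (ae_of_all _ fun x => ?_)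
    rw [norm_mul, norm_e, one_mul]
    exact norm_profile_le ..
  rw [integral_unif_eq_sum hint c]
  simp only [integral_e_mul_profile_arc]
  rw [← Finset.sum_mul, ← Finset.sum_div, sum_e_mul_windowSum,
    integral_e_neg_mul (div_ne_zero hy hc), coef, Complex.real_smul]
  generalize ∑ n ∈ Finset.Icc 1 N, slow δ n * e (n * ((j - y) / c)) = S
  push_cast
  field_simp

end Coefficients

theorem intCast_sub_ne_zero {y : ℝ} (hy : y ∈ Set.Ioo (0 : ℝ) 1) (j : ℤ) : (j : ℝ) - y ≠ 0 := by
  rintro h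
  have hj : (j : ℝ) ∈ Set.Ioo (0 : ℝ) 1 := sub_eq_zero.1 h ▸ hy
  have hpos : 0 < j := by exact_mod_cast hj.1
  have hlt : j < 1 := by exact_mod_cast hj.2
  omega

theorem half_abs_le_abs_sub {y : ℝ} (hy : y ∈ Set.Ioo (0 : ℝ) 1) {j : ℤ} (h0 : j ≠ 0)
    (h1 : j ≠ 1) : |(j : ℝ)| / 2 ≤ |(j : ℝ) - y| := by
  rcases lt_or_gt_of_ne h0 with hneg | hpos
  · have hj : (j : ℝ) < 0 := by exact_mod_cast hneg
    rw [abs_of_neg hj, abs_of_neg (by linarith [hy.1])]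
    linarith [hy.1]
  · have hj : (2 : ℝ) ≤ j := by exact_mod_cast (by omega : (2 : ℤ) ≤ j)
    rw [abs_of_pos (by linarith), abs_of_pos (by linarith [hy.2])]
    linarith [hy.2]

theorem norm_two_pi_I_mul (x : ℝ) : ‖(2 * Real.pi * Complex.I * x : ℂ)‖ = 2 * Real.pi * |x| := by
  simp [abs_of_pos Real.pi_pos]

theorem norm_e_neg_sub_one_pos {y : ℝ} (hy : y ∈ Set.Ioo (0 : ℝ) 1) : 0 < ‖e (-y) - 1‖ := by
  rw [norm_pos_iff, sub_ne_zero]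
  intro hey
  obtain ⟨m, hm⟩ := e_eq_one_iff.1 hey
  exact intCast_sub_ne_zero hy (-m) (by push_cast; linarith)

section CoefficientBounds

variable {N c : ℕ} [NeZero c] {d : ℤ} (hd : IsUnit (d : ZMod c)) {δ C : ℝ} {y : ℝ}

theorem norm_e_neg_sub_one_le (y : ℝ) (j : ℤ) :
    ‖e (-y) - 1‖ ≤ c * ‖e ((j - y) / c) - 1‖ := by
  have hey : e (-y) = e (c * ((j - y) / c)) := by
    rw [mul_div_cancel₀ _ (NeZero.ne (c : ℝ)), sub_eq_neg_add, e_add_int]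
  rw [hey]
  exact norm_e_mul_sub_one_le c _

include hd

theorem norm_gauss_div (j : ℤ) : ‖gauss c d j / √c‖ = 1 := by
  obtain ⟨z, hz⟩ := hd.exists_right_inv
  obtain ⟨a, rfl⟩ := ZMod.intCast_surjective z
  obtain ⟨σ, hσ⟩ := exists_gauss_eq hz
  have hc : √(c : ℝ) ≠ 0 := (Real.sqrt_pos.2 (Nat.cast_pos.2 (NeZero.pos c))).ne'
  rw [hσ, norm_div, norm_mul, norm_e, one_mul, norm_gauss_zero hd,
    Complex.norm_of_nonneg (Real.sqrt_nonneg _), div_self hc]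

variable (hC : (N : ℝ) ^ 2 * |δ| ≤ C) (hy : y ∈ Set.Ioo (0 : ℝ) 1)
include hC hy

theorem norm_coef_le (j : ℤ) : ‖coef N c d δ y j‖ ≤ (2 + 2 * Real.pi * C) / |j - y| := by
  have hC0 : 0 ≤ C := le_trans (by positivity) hC
  have hj : 0 < |(j : ℝ) - y| := abs_pos.2 (intCast_sub_ne_zero hy j)
  rw [coef, norm_mul, norm_gauss_div hd, one_mul, norm_div, norm_two_pi_I_mul]
  refine div_le_div₀ (by positivity) (norm_slow_sum_le hC _) hj ?_
  exact le_mul_of_one_le_left hj.le (by linarith [Real.pi_gt_three])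

theorem norm_coef_sub_boundaryCoef_le (hN : 0 < N) (j : ℤ) :
    ‖coef N c d δ y j - boundaryCoef N c d δ y j‖ ≤
      (4 * Real.pi * C + (2 * Real.pi * C) ^ 2) / (‖e (-y) - 1‖ * |j - y|) * (c / N) := by
  have hj : 0 < |(j : ℝ) - y| := abs_pos.2 (intCast_sub_ne_zero hy j)
  have he := norm_e_neg_sub_one_pos hy
  rw [coef, boundaryCoef, ← mul_sub, norm_mul, norm_gauss_div hd, one_mul, ← sub_div, norm_div,
    norm_two_pi_I_mul]
  have hparts := norm_slow_sum_sub_le hC ((j - y) / c)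
  set E := ‖(1 - e (-((j - y) / c))) * ∑ n ∈ Finset.Icc 1 N, slow δ n * e (n * ((j - y) / c)) -
    (slow δ N * e (N * ((j - y) / c)) - 1)‖
  have hE : ‖e (-y) - 1‖ * E ≤ (4 * Real.pi * C + (2 * Real.pi * C) ^ 2) * (c / N) := by
    calc ‖e (-y) - 1‖ * E ≤ c * ‖e ((j - y) / c) - 1‖ * E := by
          gcongr
          exact norm_e_neg_sub_one_le y j
      _ = N * (‖e ((j - y) / c) - 1‖ * E) * (c / N) := by field_simp
      _ ≤ _ := by gcongr
  calc E / (2 * Real.pi * |(j : ℝ) - y|) ≤ E / |(j : ℝ) - y| := by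
        gcongr
        exact le_mul_of_one_le_left hj.le (by linarith [Real.pi_gt_three])
    _ = ‖e (-y) - 1‖ * E / (‖e (-y) - 1‖ * |(j : ℝ) - y|) := by field_simp
    _ ≤ (4 * Real.pi * C + (2 * Real.pi * C) ^ 2) * (c / N) /
          (‖e (-y) - 1‖ * |(j : ℝ) - y|) := by gcongr
    _ = _ := by ring

end CoefficientBounds

/-! ### Truncating the Fourier series in mean -/

theorem fourierCoeffOn_eq_integral_unif (f : ℝ → ℂ) (j : ℤ) :
    fourierCoeffOn zero_lt_one f j = ∫ x, e (-(j * x)) * f x ∂unif := by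
  rw [fourierCoeffOn_eq_integral, integral_unif_eq, sub_zero, div_one, one_smul]
  congr 1
  funext x
  rw [fourier_coe_apply, smul_eq_mul, e]
  congr 2
  push_cast
  ring

section FourierSum

variable {f : ℝ → ℂ} (hf : Measurable f) {B : ℝ} (hB : ∀ x, ‖f x‖ ≤ B)

theorem integral_e_mul_fourierSum (a : ℤ → ℂ) (s : Finset ℤ) (j : ℤ) :
    ∫ x, e (-(j * x)) * ∑ i ∈ s, a i * e (i * x) ∂unif = if j ∈ s then a j else 0 := by
  have hterm : ∀ (i : ℤ) (x : ℝ),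
      e (-(j * x)) * (a i * e (i * x)) = a i * e ((i - j : ℤ) * x) := fun i x => by
    have hphase : e ((i - j : ℤ) * x) = e (-(j * x)) * e (i * x) := by
      rw [← e_add]
      congr 1
      push_cast
      ring
    rw [hphase]
    ring
  simp only [Finset.mul_sum, hterm]
  rw [integral_finsetSum _ fun i _ => integrable_unif_of_continuous (by fun_prop),
    ← Finset.sum_ite_eq' s j a]
  refine Finset.sum_congr rfl fun i _ => ?_
  rw [integral_const_mul]
  split_ifs with hij
  · simp [hij, e_zero]
  · rw [integral_e_int _ (sub_ne_zero.2 hij), mul_zero]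

include hf hB

theorem hasSum_sq_norm_integral_e_mul :
    HasSum (fun j : ℤ => ‖∫ x, e (-(j * x)) * f x ∂unif‖ ^ 2) (∫ x, ‖f x‖ ^ 2 ∂unif) := by
  have h := hasSum_sq_fourierCoeffOn (f := f) zero_lt_one
    (MemLp.of_bound hf.aestronglyMeasurable B (ae_of_all _ hB))
  simp only [fourierCoeffOn_eq_integral_unif] at h
  rwa [sub_zero, inv_one, one_smul, ← integral_unif_eq] at h

theorem sq_integral_norm_le : (∫ x, ‖f x‖ ∂unif) ^ 2 ≤ ∫ x, ‖f x‖ ^ 2 ∂unif := by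
  have hbound : ∀ x, ‖f x‖ ^ 2 ≤ B ^ 2 := fun x => by
    gcongr
    exact hB x
  refine (even_two.convexOn_pow (𝕜 := ℝ)).map_integral_le (by fun_prop) isClosed_univ
    (ae_of_all _ fun _ => Set.mem_univ _)
    (Integrable.of_bound hf.aestronglyMeasurable B (ae_of_all _ hB)).norm
    (Integrable.of_bound (hf.norm.pow_const 2).aestronglyMeasurable (B ^ 2)
      (ae_of_all _ fun x => (Real.norm_of_nonneg (sq_nonneg ‖f x‖)).trans_le (hbound x)))

theorem integral_norm_sub_fourierSum_le {a : ℤ → ℂ}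
    (ha : ∀ j : ℤ, ∫ x, e (-(j * x)) * f x ∂unif = a j) {b : ℤ → ℝ} (hb : Summable b)
    {s : Finset ℤ} (hab : ∀ j ∉ s, ‖a j‖ ^ 2 ≤ b j) :
    ∫ x, ‖f x - ∑ j ∈ s, a j * e (j * x)‖ ∂unif ≤ √(∑' j : {j // j ∉ s}, b j) := by
  set g : ℝ → ℂ := fun x => f x - ∑ j ∈ s, a j * e (j * x) with hg
  have hgm : Measurable g := by fun_prop
  have hgB : ∀ x, ‖g x‖ ≤ B + ∑ j ∈ s, ‖a j‖ := fun x =>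
    norm_sub_le_of_le (hB x) (norm_sum_le_of_le _ fun j _ => by rw [norm_mul, norm_e, mul_one])
  have hcoef : ∀ j : ℤ, ∫ x, e (-(j * x)) * g x ∂unif = if j ∈ s then 0 else a j := fun j => by
    have hint : Integrable (fun x => e (-(j * x)) * f x) unif :=
      Integrable.of_bound (Measurable.aestronglyMeasurable (by fun_prop)) B
        (ae_of_all _ fun x => by rw [norm_mul, norm_e, one_mul]; exact hB x)
    simp only [hg, mul_sub]
    rw [integral_sub hint (integrable_unif_of_continuous (by fun_prop)), ha,
      integral_e_mul_fourierSum]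
    split_ifs <;> simp
  have hparseval := hasSum_sq_norm_integral_e_mul hgm hgB
  simp only [hcoef] at hparseval
  refine Real.le_sqrt_of_sq_le ((sq_integral_norm_le hgm hgB).trans ?_)
  rw [← hparseval.tsum_eq]
  refine (hparseval.summable.tsum_le_tsum (fun j => ?_) (hb.indicator {j | j ∉ s})).trans_eq
    (tsum_subtype {j | j ∉ s} b).symm
  by_cases hj : j ∈ s
  · simp [hj]
  · simpa [hj] using hab j hj

end FourierSum

theorem integral_norm_profile_sub_coefSum_le {N c : ℕ} [NeZero c] {d : ℤ}
    (hd : IsUnit (d : ZMod c)) {δ C : ℝ} (hC : (N : ℝ) ^ 2 * |δ| ≤ C) {y : ℝ}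
    (hy : y ∈ Set.Ioo (0 : ℝ) 1) {s : Finset ℤ} (h0 : 0 ∈ s) (h1 : 1 ∈ s) :
    ∫ x, ‖profile N c d δ y x - coefSum N c d δ s y x‖ ∂unif ≤
      2 * (2 + 2 * Real.pi * C) * √(∑' j : {j // j ∉ s}, 1 / (j : ℝ) ^ 2) := by
  set B := 2 * (2 + 2 * Real.pi * C) with hBdef
  have hC0 : 0 ≤ C := le_trans (by positivity) hC
  have hB0 : 0 ≤ B := by positivity
  have hcoef : ∀ j ∉ s, ‖coef N c d δ y j‖ ^ 2 ≤ B ^ 2 * (1 / (j : ℝ) ^ 2) := fun j hj => by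
    have hj0 : j ≠ 0 := fun h => hj (h ▸ h0)
    have hj1 : j ≠ 1 := fun h => hj (h ▸ h1)
    have hle : ‖coef N c d δ y j‖ ≤ B / |(j : ℝ)| := by
      calc ‖coef N c d δ y j‖ ≤ (2 + 2 * Real.pi * C) / |j - y| := norm_coef_le hd hC hy j
        _ ≤ (2 + 2 * Real.pi * C) / (|(j : ℝ)| / 2) := by
          gcongr
          exact half_abs_le_abs_sub hy hj0 hj1
        _ = B / |(j : ℝ)| := by
          rw [hBdef]
          field_simp
    calc ‖coef N c d δ y j‖ ^ 2 ≤ (B / |(j : ℝ)|) ^ 2 := by gcongr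
      _ = B ^ 2 * (1 / (j : ℝ) ^ 2) := by rw [div_pow, sq_abs, mul_one_div]
  refine (integral_norm_sub_fourierSum_le (measurable_profile_right N c d δ y)
    (norm_profile_le N c d δ y)
    (fun j => integral_e_mul_profile N d j δ (intCast_sub_ne_zero hy j))
    ((Real.summable_one_div_int_pow.2 one_lt_two).mul_left (B ^ 2)) hcoef).trans_eq ?_
  rw [tsum_mul_left, Real.sqrt_mul (sq_nonneg B), Real.sqrt_sq hB0]

/-! ### Averaging over a fast phase -/

theorem tendstoUniformly_indicator {X T E : Type*} [TopologicalSpace X] [UniformSpace E] [Zero E]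
    {A : T → X → E} {s : Set X}
    (hA : ∀ y ∈ s, TendstoUniformly (fun y' t => A t y') (fun t => A t y) (𝓝 y)) {y : X}
    (hy : y ∉ frontier s) :
    TendstoUniformly (fun y' t => s.indicator (A t) y') (fun t => s.indicator (A t) y) (𝓝 y) := by
  intro u hu
  rw [frontier_eq_closure_inter_closure, Set.mem_inter_iff, not_and_or] at hy
  rcases hy with hout | hin
  · have hnear : ∀ᶠ y' in 𝓝 y, y' ∉ s :=
      (isClosed_closure.isOpen_compl.eventually_mem hout).mono fun _ h h' => h (subset_closure h')
    filter_upwards [hnear] with y' hy' t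
    rw [Set.indicator_of_notMem hnear.self_of_nhds, Set.indicator_of_notMem hy']
    exact refl_mem_uniformity hu
  · have hnear : ∀ᶠ y' in 𝓝 y, y' ∈ s :=
      (isClosed_closure.isOpen_compl.eventually_mem hin).mono fun _ h =>
        by_contra fun h' => h (subset_closure h')
    filter_upwards [hnear, hA y hnear.self_of_nhds u hu] with y' hy' hu' t
    rw [Set.indicator_of_mem hnear.self_of_nhds, Set.indicator_of_mem hy']
    exact hu' t

theorem tendsto_sub_of_tendstoUniformly {T ι : Type*} {l : Filter ι} {f : ι → T → ℝ} {g : T → ℝ}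
    (hf : TendstoUniformly f g l) (θ : ι → T) :
    Tendsto (fun i => f i (θ i) - g (θ i)) l (𝓝 0) := by
  refine Metric.tendsto_nhds.2 fun ε hε => ?_
  filter_upwards [Metric.tendstoUniformly_iff.1 hf ε hε] with i hi
  rw [dist_zero_right, ← dist_eq_norm, dist_comm]
  exact hi (θ i)

section FastPhase

variable {A : ℝ → ℝ → ℝ} (hA : Measurable (Function.uncurry A))
  {K : ℝ} (hK : ∀ t y, |A t y| ≤ K)
include hA

theorem measurable_indicator_comp {θ : ℝ → ℝ} (hθ : Measurable θ) (h : ℝ) :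
    Measurable fun y => (Set.Ioo (0 : ℝ) 1).indicator (A (θ y)) (y + h) := by
  have hcomp : Measurable fun y => A (θ y) (y + h) :=
    hA.comp (hθ.prodMk (measurable_id.add_const h))
  exact hcomp.indicator (measurableSet_Ioo.preimage (measurable_add_const h))

include hK

theorem integrable_indicator_comp {θ : ℝ → ℝ} (hθ : Measurable θ) (h : ℝ) :
    Integrable fun y => (Set.Ioo (0 : ℝ) 1).indicator (A (θ y)) (y + h) := by
  have hbound : Integrable ((Set.Ioo (-h) (1 - h)).indicator fun _ => K) :=
    (integrable_indicator_iff measurableSet_Ioo).2 (integrableOn_const measure_Ioo_lt_top.ne)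
  refine hbound.mono' (measurable_indicator_comp hA hθ h).aestronglyMeasurable
    (ae_of_all _ fun y => ?_)
  have hmem : y + h ∈ Set.Ioo (0 : ℝ) 1 ↔ y ∈ Set.Ioo (-h) (1 - h) := by
    rw [Set.mem_Ioo, Set.mem_Ioo, neg_lt_iff_pos_add, lt_sub_iff_add_lt]
  by_cases hy : y ∈ Set.Ioo (-h) (1 - h)
  · rw [Set.indicator_of_mem (hmem.2 hy), Set.indicator_of_mem hy]
    exact hK _ _
  · rw [Set.indicator_of_notMem (mt hmem.1 hy), Set.indicator_of_notMem hy, norm_zero]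

theorem integral_phase_eq (hper : ∀ y, Function.Periodic (fun t => A t y) 1) (M κ : ℝ) :
    ∫ τ, ∫ y, A (M * y + κ + τ) y ∂unif ∂unif = ∫ t, ∫ y, A t y ∂unif ∂unif := by
  have hint : ∀ f : ℝ × ℝ → ℝ, Measurable f →
      Integrable (fun z : ℝ × ℝ => A (f z) z.2) (unif.prod unif) := fun f hf =>
    Integrable.of_bound (hA.comp (hf.prodMk measurable_snd)).aestronglyMeasurable K
      (ae_of_all _ fun z => hK _ _)
  rw [integral_integral_swap (hint (fun z => M * z.2 + κ + z.1) (by fun_prop)),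
    integral_integral_swap (hint Prod.fst measurable_fst)]
  refine integral_congr_ae (ae_of_all _ fun y => ?_)
  simpa only [add_comm] using integral_unif_add_right (hper y) (M * y + κ)

variable (hcont : ∀ y ∈ Set.Ioo (0 : ℝ) 1,
    TendstoUniformly (fun y' t => A t y') (fun t => A t y) (𝓝 y))
  {ι : Type*} {l : Filter ι} [l.IsCountablyGenerated]
include hcont

theorem tendsto_integral_indicator_translate_sub {θ : ι → ℝ → ℝ} (hθ : ∀ i, Measurable (θ i))
    {h : ι → ℝ} (hh : Tendsto h l (𝓝 0)) :
    Tendsto (fun i => ∫ y, ((Set.Ioo (0 : ℝ) 1).indicator (A (θ i y)) (y + h i) -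
      (Set.Ioo (0 : ℝ) 1).indicator (A (θ i y)) y)) l (𝓝 0) := by
  have hmeas : ∀ i, Measurable fun y => (Set.Ioo (0 : ℝ) 1).indicator (A (θ i y)) (y + h i) -
      (Set.Ioo (0 : ℝ) 1).indicator (A (θ i y)) y := fun i => by
    have hzero := measurable_indicator_comp hA (hθ i) 0
    simp only [add_zero] at hzero
    exact (measurable_indicator_comp hA (hθ i) (h i)).sub hzero
  have hind : ∀ t y, ‖(Set.Ioo (0 : ℝ) 1).indicator (A t) y‖ ≤ K := fun t y =>
    (norm_indicator_le_norm_self _ _).trans (hK t y)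
  have hbound : ∀ᶠ i in l, ∀ᵐ y, ‖(Set.Ioo (0 : ℝ) 1).indicator (A (θ i y)) (y + h i) -
      (Set.Ioo (0 : ℝ) 1).indicator (A (θ i y)) y‖ ≤
        (Set.Icc (-1 : ℝ) 2).indicator (fun _ => K + K) y := by
    filter_upwards [hh.eventually (Icc_mem_nhds (a := -1) (b := 1) (by simp) (by simp))] with i hi
    refine ae_of_all _ fun y => ?_
    by_cases hy : y ∈ Set.Icc (-1 : ℝ) 2
    · simpa only [Set.indicator_of_mem hy] using norm_sub_le_of_le (hind _ _) (hind _ _)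
    · have hy0 : y ∉ Set.Ioo (0 : ℝ) 1 := fun hy' => hy ⟨by linarith [hy'.1], by linarith [hy'.2]⟩
      have hyh : y + h i ∉ Set.Ioo (0 : ℝ) 1 := fun hy' =>
        hy ⟨by linarith [hy'.1, hi.2], by linarith [hy'.2, hi.1]⟩
      simp [hy, hy0, hyh]
  have hlim : ∀ᵐ y, Tendsto (fun i => (Set.Ioo (0 : ℝ) 1).indicator (A (θ i y)) (y + h i) -
      (Set.Ioo (0 : ℝ) 1).indicator (A (θ i y)) y) l (𝓝 0) := by
    filter_upwards [measure_eq_zero_iff_ae_notMem.1 ((convex_Ioo (0 : ℝ) 1).addHaar_frontier _)]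
      with y hy
    have hyh : Tendsto (fun i => y + h i) l (𝓝 y) := by simpa only [add_zero] using hh.const_add y
    exact tendsto_sub_of_tendstoUniformly
      (fun u hu => hyh.eventually (tendstoUniformly_indicator hcont hy u hu)) fun i => θ i y
  simpa only [integral_zero] using tendsto_integral_filter_of_dominated_convergence _
    (Eventually.of_forall fun i => (hmeas i).aestronglyMeasurable) hbound
    ((integrable_indicator_iff measurableSet_Icc).2
      (integrableOn_const measure_Icc_lt_top.ne)) hlim

theorem tendsto_integral_phase_sub {M : ι → ℝ} (hM : Tendsto M l atTop) (κ : ι → ℝ) (τ : ℝ) :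
    Tendsto (fun i => ∫ y, A (M i * y + κ i) y ∂unif - ∫ y, A (M i * y + κ i + τ) y ∂unif) l
      (𝓝 0) := by
  have hunif : ∀ θ : ℝ → ℝ,
      ∫ y, A (θ y) y ∂unif = ∫ y, (Set.Ioo (0 : ℝ) 1).indicator (A (θ y)) y := fun θ => by
    rw [unif, ← restrict_Ioo_eq_restrict_Ico]
    exact (integral_indicator measurableSet_Ioo).symm
  have hθ : ∀ i, Measurable fun y => M i * y + κ i + τ := fun i => by fun_prop
  refine (tendsto_integral_indicator_translate_sub hA hK hcont hθ
    (hM.const_div_atTop τ)).congr' ?_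
  filter_upwards [hM.eventually_ne_atTop 0] with i hi
  have hint := integrable_indicator_comp hA hK (hθ i)
  have hshift : ∀ y, M i * (y + τ / M i) + κ i = M i * y + κ i + τ := fun y => by
    field_simp
    ring
  have htranslate := integral_add_right_eq_self (μ := volume)
    (fun y => (Set.Ioo (0 : ℝ) 1).indicator (A (M i * y + κ i)) y) (τ / M i)
  simp only [hshift] at htranslate
  rw [integral_sub (hint _) (by simpa only [add_zero] using hint 0), hunif, hunif, htranslate]

/-- Shifting the phase by `τ` costs nothing in the limit, so the phase may be averaged over `τ`. -/
theorem tendsto_integral_phase (hper : ∀ y, Function.Periodic (fun t => A t y) 1) {M : ι → ℝ}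
    (hM : Tendsto M l atTop) (κ : ι → ℝ) :
    Tendsto (fun i => ∫ y, A (M i * y + κ i) y ∂unif) l (𝓝 (∫ t, ∫ y, A t y ∂unif ∂unif)) := by
  have hmeas : ∀ i, Measurable fun τ => ∫ y, A (M i * y + κ i + τ) y ∂unif := fun i => by
    have hjoint : Measurable fun z : ℝ × ℝ => A (M i * z.2 + κ i + z.1) z.2 :=
      hA.comp (((by fun_prop : Measurable fun z : ℝ × ℝ => M i * z.2 + κ i + z.1)).prodMk
        measurable_snd)
    exact hjoint.stronglyMeasurable.integral_prod_right.measurable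
  have hmean : ∀ f : ℝ → ℝ, ‖∫ y, A (f y) y ∂unif‖ ≤ K := fun f =>
    norm_integral_le_of_ae_bound (ae_of_all _ fun y => hK _ _)
  have hint : ∀ i, Integrable (fun τ => ∫ y, A (M i * y + κ i + τ) y ∂unif) unif := fun i =>
    Integrable.of_bound (hmeas i).aestronglyMeasurable K (ae_of_all _ fun τ => hmean _)
  have hlim := tendsto_integral_filter_of_dominated_convergence (μ := unif) (f := fun _ => (0 : ℝ))
    (F := fun i τ => ∫ y, A (M i * y + κ i) y ∂unif - ∫ y, A (M i * y + κ i + τ) y ∂unif)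
    (fun _ => K + K)
    (Eventually.of_forall fun i => (measurable_const.sub (hmeas i)).aestronglyMeasurable)
    (Eventually.of_forall fun i => ae_of_all _ fun τ => norm_sub_le_of_le (hmean _) (hmean _))
    (integrable_const _)
    (ae_of_all _ fun τ => tendsto_integral_phase_sub hA hK hcont hM κ τ)
  refine tendsto_sub_nhds_zero_iff.1 ?_
  simpa only [integral_zero, integral_sub (integrable_const _) (hint _), integral_const,
    probReal_univ, one_smul, integral_phase_eq hA hK hper] using hlim

end FastPhase

/-! ### Truncations of the random series -/

/-- The factor of the `n`-th term of the random series that depends on `y`. -/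
def termAmp (ω : ℝ) (n : ℤ) (y : ℝ) : ℂ := e (1 / 2 * ((n : ℝ) - y) ^ 2 * ω) / ((n : ℂ) - (y : ℂ))

/-- The truncation of the random series to a finite set of indices, divided by `2π`. -/
def trunc (ω φ : ℝ) (s : Finset ℤ) (z : ℝ × ℝ × ℝ) : ℂ :=
  (∑ n ∈ s, seriesTerm ω φ n z) / (2 * Real.pi)

section Trunc

variable (ω φ : ℝ) (s : Finset ℤ)

theorem seriesTerm_eq (n : ℤ) (t x y : ℝ) :
    seriesTerm ω φ n (t, x, y) = (1 + e t * e (-(n * φ))) * e (n * x) * termAmp ω n y := by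
  rw [seriesTerm, termAmp, e_add, sub_eq_add_neg t, e_add]
  ring

theorem measurable_trunc : Measurable (trunc ω φ s) :=
  (Finset.measurable_sum _ fun n _ => measurable_seriesTerm ω φ n).div_const _

theorem measurable_trunc_mid (t y : ℝ) : Measurable fun x => trunc ω φ s (t, x, y) :=
  (measurable_trunc ω φ s).comp (by fun_prop : Measurable fun x : ℝ => (t, x, y))

theorem trunc_periodic_left (x y : ℝ) :
    Function.Periodic (fun t => trunc ω φ s (t, x, y)) 1 := fun t => by
  simp only [trunc, seriesTerm_eq, e_periodic t]

theorem trunc_periodic_mid (t y : ℝ) :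
    Function.Periodic (fun x => trunc ω φ s (t, x, y)) 1 := fun x => by
  have he : ∀ n : ℤ, e (n * (x + 1)) = e (n * x) := fun n => e_eq_of_sub_eq_int n (by ring)
  simp only [trunc, seriesTerm_eq, he]

theorem trunc_fract : trunc ω (Int.fract φ) s = trunc ω φ s := by
  have he : ∀ n : ℤ, e (-(n * Int.fract φ)) = e (-(n * φ)) := fun n =>
    e_eq_of_sub_eq_int (n * ⌊φ⌋) (by rw [Int.fract, Int.cast_mul]; ring)
  funext ⟨t, x, y⟩
  simp only [trunc, seriesTerm_eq, he]

theorem norm_trunc_sub_trunc_le (ω' φ' t x y y' : ℝ) :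
    ‖trunc ω' φ' s (t, x, y') - trunc ω φ s (t, x, y)‖ ≤
      ∑ n ∈ s, (‖termAmp ω' n y' - termAmp ω n y‖ +
        ‖e (-(n * φ')) * termAmp ω' n y' - e (-(n * φ)) * termAmp ω n y‖) := by
  have hterm : ∀ n ∈ s, ‖seriesTerm ω' φ' n (t, x, y') - seriesTerm ω φ n (t, x, y)‖ ≤
      ‖termAmp ω' n y' - termAmp ω n y‖ +
        ‖e (-(n * φ')) * termAmp ω' n y' - e (-(n * φ)) * termAmp ω n y‖ := fun n _ => by
    have hsplit : seriesTerm ω' φ' n (t, x, y') - seriesTerm ω φ n (t, x, y) =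
        e (n * x) * ((termAmp ω' n y' - termAmp ω n y) +
          e t * (e (-(n * φ')) * termAmp ω' n y' - e (-(n * φ)) * termAmp ω n y)) := by
      rw [seriesTerm_eq, seriesTerm_eq]
      ring
    rw [hsplit, norm_mul, norm_e, one_mul]
    exact (norm_add_le _ _).trans_eq (by rw [norm_mul, norm_e, one_mul])
  have hpi : ‖(2 * Real.pi : ℂ)‖ = 2 * Real.pi := by simp [abs_of_pos Real.pi_pos]
  rw [trunc, trunc, ← sub_div, ← Finset.sum_sub_distrib, norm_div, hpi]
  exact (div_le_self (norm_nonneg _) (by linarith [Real.pi_gt_three])).trans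
    (norm_sum_le_of_le _ hterm)

end Trunc

section TruncLimit

variable {ι : Type*} {l : Filter ι} {ω φ y : ℝ} {ω' φ' y' : ι → ℝ}

theorem tendsto_termAmp (n : ℤ) (hy : y ∈ Set.Ioo (0 : ℝ) 1) (hω : Tendsto ω' l (𝓝 ω))
    (hy' : Tendsto y' l (𝓝 y)) :
    Tendsto (fun i => termAmp (ω' i) n (y' i)) l (𝓝 (termAmp ω n y)) := by
  have hden : (n : ℂ) - y ≠ 0 := by exact_mod_cast intCast_sub_ne_zero hy n
  exact ((continuous_e.tendsto _).comp ((((hy'.const_sub _).pow 2).const_mul _).mul hω)).div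
    (((Complex.continuous_ofReal.tendsto _).comp hy').const_sub _) hden

theorem tendstoUniformly_trunc (s : Finset ℤ) (hy : y ∈ Set.Ioo (0 : ℝ) 1)
    (hω : Tendsto ω' l (𝓝 ω)) (hφ : Tendsto φ' l (𝓝 φ)) (hy' : Tendsto y' l (𝓝 y)) :
    TendstoUniformly (fun i (p : ℝ × ℝ) => trunc (ω' i) (φ' i) s (p.1, p.2, y' i))
      (fun p => trunc ω φ s (p.1, p.2, y)) l := by
  have hbound : Tendsto (fun i => ∑ n ∈ s, (‖termAmp (ω' i) n (y' i) - termAmp ω n y‖ +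
      ‖e (-(n * φ' i)) * termAmp (ω' i) n (y' i) - e (-(n * φ)) * termAmp ω n y‖)) l (𝓝 0) := by
    rw [← Finset.sum_const_zero (s := s)]
    refine tendsto_finsetSum _ fun n _ => ?_
    have hamp := tendsto_termAmp n hy hω hy'
    have he : Tendsto (fun i => e (-(n * φ' i))) l (𝓝 (e (-(n * φ)))) :=
      (continuous_e.tendsto _).comp ((hφ.const_mul _).neg)
    simpa only [add_zero] using (tendsto_iff_norm_sub_tendsto_zero.1 hamp).add
      (tendsto_iff_norm_sub_tendsto_zero.1 (he.mul hamp))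
  refine Metric.tendstoUniformly_iff.2 fun ε hε => ?_
  filter_upwards [hbound.eventually_lt_const hε] with i hi p
  rw [dist_comm, dist_eq_norm]
  exact (norm_trunc_sub_trunc_le ..).trans_lt hi

end TruncLimit

/-- The mean over `x` of a radial test function `G` of the truncated series. -/
def truncMean (G : ℝ → ℝ) (ω φ : ℝ) (s : Finset ℤ) (t y : ℝ) : ℝ :=
  ∫ x, G ‖trunc ω φ s (t, x, y)‖ ∂unif

section TruncMean

variable {G : ℝ → ℝ} (s : Finset ℤ)

theorem truncMean_periodic (ω φ y : ℝ) :
    Function.Periodic (fun t => truncMean G ω φ s t y) 1 := fun t => by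
  simp only [truncMean, trunc_periodic_left ω φ s _ y t]

theorem measurable_truncMean (hG : Continuous G) (ω φ : ℝ) :
    Measurable (Function.uncurry (truncMean G ω φ s)) := by
  have hjoint : Measurable fun p : (ℝ × ℝ) × ℝ => G ‖trunc ω φ s (p.1.1, p.2, p.1.2)‖ :=
    hG.measurable.comp ((measurable_trunc ω φ s).comp (by fun_prop)).norm
  exact hjoint.stronglyMeasurable.integral_prod_right'.measurable

theorem abs_truncMean_le {K : ℝ} (hK : ∀ r, |G r| ≤ K) (ω φ t y : ℝ) :
    |truncMean G ω φ s t y| ≤ K := by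
  rw [truncMean, ← Real.norm_eq_abs]
  exact norm_integral_le_of_ae_bound (ae_of_all _ fun _ => hK _)

theorem integral_truncMean (hG : Continuous G) {K : ℝ} (hK : ∀ r, |G r| ≤ K) (ω φ : ℝ) :
    ∫ t, ∫ y, truncMean G ω φ s t y ∂unif ∂unif = ∫ z, G ‖trunc ω φ s z‖ ∂unif3 := by
  rw [unif3, integral_prod _ (integrable_comp_of_bounded hG hK (measurable_trunc ω φ s).norm)]
  refine integral_congr_ae (ae_of_all _ fun t => ?_)
  have hmeas : Measurable fun p : ℝ × ℝ => ‖trunc ω φ s (t, p)‖ :=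
    ((measurable_trunc ω φ s).comp measurable_prodMk_left).norm
  exact (integral_prod_symm _ (integrable_comp_of_bounded hG hK hmeas)).symm

theorem tendstoUniformly_truncMean (hG : UniformContinuous G) {K : ℝ} (hK : ∀ r, |G r| ≤ K)
    {ι : Type*} {l : Filter ι} {ω φ y : ℝ} {ω' φ' y' : ι → ℝ} (hy : y ∈ Set.Ioo (0 : ℝ) 1)
    (hω : Tendsto ω' l (𝓝 ω)) (hφ : Tendsto φ' l (𝓝 φ)) (hy' : Tendsto y' l (𝓝 y)) :
    TendstoUniformly (fun i t => truncMean G (ω' i) (φ' i) s t (y' i))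
      (fun t => truncMean G ω φ s t y) l := by
  have hcomp := (hG.comp uniformContinuous_norm).comp_tendstoUniformly
    (tendstoUniformly_trunc s hy hω hφ hy')
  have hint : ∀ ω φ t y, Integrable (fun x => G ‖trunc ω φ s (t, x, y)‖) unif := fun ω φ t y =>
    integrable_comp_of_bounded hG.continuous hK (measurable_trunc_mid ω φ s t y).norm
  refine Metric.tendstoUniformly_iff.2 fun ε hε => ?_
  filter_upwards [Metric.tendstoUniformly_iff.1 hcomp (ε / 2) (half_pos hε)] with i hi t
  rw [dist_eq_norm, truncMean, truncMean, ← integral_sub (hint ..) (hint ..)]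
  refine (norm_integral_le_of_ae_bound (ae_of_all _ fun x => ?_)).trans_lt (half_lt_self hε)
  exact (hi (t, x)).le

end TruncMean

/-! ### Comparison of the Fourier sums with the truncated series -/

theorem slow_mul_e_sub_one_eq (N c : ℕ) (δ y : ℝ) (j : ℤ) :
    slow δ N * e (N * ((j - y) / c)) - 1 = e (δ * (N * (N - 1) / 2) - N * y / c) * e (j * (N / c)) *
      (1 + e (N / c * y + (1 / 2 - δ * (N * (N - 1) / 2))) * e (-(j * (N / c)))) := by
  have hhalf : e (1 / 2) = -1 := by
    rw [e, ← Complex.exp_pi_mul_I]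
    congr 1
    push_cast
    ring
  have hphase : slow δ N * e (N * ((j - y) / c)) =
      e (δ * (N * (N - 1) / 2) - N * y / c) * e (j * (N / c)) := by
    rw [slow, ← e_add, ← e_add]
    ring_nf
  have hone : e (δ * (N * (N - 1) / 2) - N * y / c) * e (j * (N / c)) *
      (e (N / c * y + (1 / 2 - δ * (N * (N - 1) / 2))) * e (-(j * (N / c)))) = -1 := by
    rw [← hhalf, ← e_add, ← e_add, ← e_add]
    ring_nf
  rw [mul_add, mul_one, hone, hphase, sub_eq_add_neg]

/-- Completing the square turns the quadratic phase of the Gauss sum into the one of the series. -/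
theorem e_mul_e_mul_e_eq (c N : ℕ) [NeZero c] (a j : ℤ) (σ y x : ℝ) :
    e (a * j ^ 2 / (2 * c) + j * σ) * e (j * (N / c)) * e (j * x) =
      e (-(1 / 2 * y ^ 2 * (a / c))) * (e (j * (x + (σ + N / c + y * (a / c)))) *
        e (1 / 2 * (j - y) ^ 2 * (a / c))) := by
  have hc : (c : ℝ) ≠ 0 := NeZero.ne _
  rw [← e_add, ← e_add, ← e_add, ← e_add]
  congr 1
  field_simp
  ring

theorem exists_sum_boundaryCoef_eq {c : ℕ} [NeZero c] {d a : ℤ} (ha : (d : ZMod c) * a = 1) (N : ℕ)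
    (δ y : ℝ) (s : Finset ℤ) :
    ∃ (U : ℂ) (r : ℝ), ‖U‖ = 1 ∧ ∀ x, ∑ j ∈ s, boundaryCoef N c d δ y j * e (j * x) =
      U * trunc (a / c) (N / c) s (N / c * y + (1 / 2 - δ * (N * (N - 1) / 2)), x + r, y) := by
  obtain ⟨σ, hσ⟩ := exists_gauss_eq ha
  refine ⟨gauss c d 0 / √c * e (δ * (N * (N - 1) / 2) - N * y / c) *
    e (-(1 / 2 * y ^ 2 * (a / c))) / Complex.I, σ + N / c + y * (a / c), ?_, fun x => ?_⟩
  · rw [norm_div, norm_mul, norm_mul, norm_gauss_div (IsUnit.of_mul_eq_one _ ha), norm_e, norm_e,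
      Complex.norm_I, mul_one, mul_one, div_one]
  rw [trunc, Finset.sum_div, Finset.mul_sum]
  refine Finset.sum_congr rfl fun j _ => ?_
  have hsq := e_mul_e_mul_e_eq c N a j σ y x
  rw [boundaryCoef, hσ, slow_mul_e_sub_one_eq, seriesTerm_eq, termAmp, Complex.ofReal_sub,
    Complex.ofReal_intCast]
  generalize (j : ℂ) - y = D
  linear_combination (gauss c d 0 / √c * e (δ * (N * (N - 1) / 2) - N * y / c) *
    (1 + e (N / c * y + (1 / 2 - δ * (N * (N - 1) / 2))) * e (-(j * (N / c)))) /
      (2 * Real.pi * Complex.I * D)) * hsq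

theorem norm_coefSum_sub_sum_boundaryCoef_le {N c : ℕ} [NeZero c] {d : ℤ}
    (hd : IsUnit (d : ZMod c)) {δ C y : ℝ} (hC : (N : ℝ) ^ 2 * |δ| ≤ C)
    (hy : y ∈ Set.Ioo (0 : ℝ) 1) (hN : 0 < N) (s : Finset ℤ) (x : ℝ) :
    ‖coefSum N c d δ s y x - ∑ j ∈ s, boundaryCoef N c d δ y j * e (j * x)‖ ≤
      (∑ j ∈ s, (4 * Real.pi * C + (2 * Real.pi * C) ^ 2) / (‖e (-y) - 1‖ * |j - y|)) *
        (c / N) := by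
  rw [coefSum, ← Finset.sum_sub_distrib, Finset.sum_mul]
  refine norm_sum_le_of_le _ fun j _ => ?_
  rw [← sub_mul, norm_mul, norm_e, mul_one]
  exact norm_coef_sub_boundaryCoef_le hd hC hy hN j

theorem abs_integral_coefSum_sub_truncMean_le {N c : ℕ} [NeZero c] {d a : ℤ}
    (ha : (d : ZMod c) * a = 1) {δ C y : ℝ} (hC : (N : ℝ) ^ 2 * |δ| ≤ C)
    (hy : y ∈ Set.Ioo (0 : ℝ) 1) (hN : 0 < N) (s : Finset ℤ) {G : ℝ → ℝ} {L : NNReal}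
    (hG : LipschitzWith L G) {K : ℝ} (hK : ∀ r, |G r| ≤ K) :
    |∫ x, G ‖coefSum N c d δ s y x‖ ∂unif - truncMean G (a / c) (Int.fract (N / c)) s
      (N / c * y + (1 / 2 - δ * (N * (N - 1) / 2))) y| ≤
      L * ((∑ j ∈ s, (4 * Real.pi * C + (2 * Real.pi * C) ^ 2) / (‖e (-y) - 1‖ * |j - y|)) *
        (c / N)) := by
  obtain ⟨U, r, hU, hsum⟩ := exists_sum_boundaryCoef_eq ha N δ y s
  set T : ℝ := N / c * y + (1 / 2 - δ * (N * (N - 1) / 2))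
  have hper : Function.Periodic (fun x => G ‖trunc (a / c) (N / c) s (T, x, y)‖) 1 := fun x => by
    simp only [trunc_periodic_mid (a / c) (N / c) s T y x]
  have hmeas : Measurable fun x => ‖trunc (a / c) (N / c) s (T, x + r, y)‖ :=
    ((measurable_trunc_mid _ _ s T y).comp (measurable_add_const r)).norm
  rw [truncMean, trunc_fract, ← integral_unif_add_right hper r, ← integral_sub
    (integrable_comp_of_bounded hG.continuous hK
      (measurable_coefSum N c d δ s).of_uncurry_left.norm)
    (integrable_comp_of_bounded hG.continuous hK hmeas), ← Real.norm_eq_abs]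
  refine norm_integral_le_of_ae_bound (ae_of_all _ fun x => ?_)
  have hnorm : ‖trunc (a / c) (N / c) s (T, x + r, y)‖ =
      ‖∑ j ∈ s, boundaryCoef N c d δ y j * e (j * x)‖ := by rw [hsum, norm_mul, hU, one_mul]
  rw [hnorm, ← dist_eq_norm]
  refine (hG.dist_le_mul _ _).trans (mul_le_mul_of_nonneg_left ?_ L.coe_nonneg)
  exact (abs_norm_sub_norm_le _ _).trans
    (norm_coefSum_sub_sum_boundaryCoef_le (IsUnit.of_mul_eq_one _ ha) hC hy hN s x)

/-! ### Passage to the limit -/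

section Mean

variable {G : ℝ → ℝ} {K : ℝ}

theorem integrable_integral_comp_norm (hG : Continuous G) (hK : ∀ r, |G r| ≤ K) {P : ℝ → ℝ → ℂ}
    (hP : Measurable (Function.uncurry P)) :
    Integrable (fun y => ∫ x, G ‖P y x‖ ∂unif) unif := by
  have hjoint : Measurable fun p : ℝ × ℝ => G ‖P p.1 p.2‖ := hG.measurable.comp hP.norm
  exact Integrable.of_bound hjoint.stronglyMeasurable.integral_prod_right'.aestronglyMeasurable K
    (ae_of_all _ fun y => norm_integral_le_of_ae_bound (ae_of_all _ fun x => hK _))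

theorem abs_integral_comp_norm_sub_le {L : NNReal} (hG : LipschitzWith L G)
    (hK : ∀ r, |G r| ≤ K) {f g : ℝ → ℂ} (hf : Measurable f) (hg : Measurable g)
    (hfg : Integrable (fun x => f x - g x) unif) :
    |∫ x, G ‖f x‖ ∂unif - ∫ x, G ‖g x‖ ∂unif| ≤ L * ∫ x, ‖f x - g x‖ ∂unif := by
  rw [← integral_sub (integrable_comp_of_bounded hG.continuous hK hf.norm)
    (integrable_comp_of_bounded hG.continuous hK hg.norm), ← integral_const_mul, ← Real.norm_eq_abs]
  refine norm_integral_le_of_norm_le (hfg.norm.const_mul _) (ae_of_all _ fun x => ?_)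
  rw [← dist_eq_norm]
  refine (hG.dist_le_mul _ _).trans (mul_le_mul_of_nonneg_left ?_ L.coe_nonneg)
  exact abs_norm_sub_norm_le _ _

theorem abs_integral_profile_sub_coefSum_le {L : NNReal} (hG : LipschitzWith L G)
    (hK : ∀ r, |G r| ≤ K) {N c : ℕ} [NeZero c] {d : ℤ} (hd : IsUnit (d : ZMod c)) {δ C : ℝ}
    (hC : (N : ℝ) ^ 2 * |δ| ≤ C) {s : Finset ℤ} (h0 : 0 ∈ s) (h1 : 1 ∈ s) :
    |∫ y, ∫ x, G ‖profile N c d δ y x‖ ∂unif ∂unif -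
      ∫ y, ∫ x, G ‖coefSum N c d δ s y x‖ ∂unif ∂unif| ≤
      L * (2 * (2 + 2 * Real.pi * C) * √(∑' j : {j // j ∉ s}, 1 / (j : ℝ) ^ 2)) := by
  rw [← integral_sub (integrable_integral_comp_norm hG.continuous hK (measurable_profile N c d δ))
    (integrable_integral_comp_norm hG.continuous hK (measurable_coefSum N c d δ s)),
    ← Real.norm_eq_abs]
  refine norm_integral_le_of_ae_bound ?_
  filter_upwards [ae_unif_mem_Ioo] with y hy
  have hprofile := measurable_profile_right N c d δ y
  have hcoefSum : Continuous (coefSum N c d δ s y) := by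
    unfold coefSum
    fun_prop
  have hint : Integrable (fun x => profile N c d δ y x - coefSum N c d δ s y x) unif :=
    (Integrable.of_bound hprofile.aestronglyMeasurable _
      (ae_of_all _ (norm_profile_le N c d δ y))).sub (integrable_unif_of_continuous hcoefSum)
  refine (abs_integral_comp_norm_sub_le hG hK hprofile hcoefSum.measurable hint).trans ?_
  gcongr
  exact integral_norm_profile_sub_coefSum_le hd hC hy h0 h1

theorem tendsto_integral_truncMean {L : NNReal} (hG : LipschitzWith L G) (hK : ∀ r, |G r| ≤ K)
    (ω φ : ℝ) (s : Finset ℤ) {ι : Type*} {l : Filter ι} [l.IsCountablyGenerated] {M : ι → ℝ}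
    (hM : Tendsto M l atTop) (κ : ι → ℝ) :
    Tendsto (fun i => ∫ y, truncMean G ω φ s (M i * y + κ i) y ∂unif) l
      (𝓝 (∫ z, G ‖trunc ω φ s z‖ ∂unif3)) := by
  rw [← integral_truncMean s hG.continuous hK]
  exact tendsto_integral_phase (measurable_truncMean s hG.continuous ω φ)
    (abs_truncMean_le s hK ω φ)
    (fun y hy => tendstoUniformly_truncMean s hG.uniformContinuous hK hy tendsto_const_nhds
      tendsto_const_nhds tendsto_id)
    (truncMean_periodic s ω φ) hM κ

theorem tendsto_integral_trunc (hG : Continuous G) (hK : ∀ r, |G r| ≤ K) (ω φ : ℝ) :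
    Tendsto (fun s => ∫ z, G ‖trunc ω φ s z‖ ∂unif3) atTop
      (𝓝 (∫ z, G ‖seriesSum ω φ z / (2 * Real.pi)‖ ∂unif3)) := by
  have hmeas : ∀ s : Finset ℤ, AEMeasurable (fun z => ∑ n ∈ s, seriesTerm ω φ n z) unif3 :=
    fun s => (Finset.measurable_sum s fun n _ => measurable_seriesTerm ω φ n).aemeasurable
  have hcont : Continuous fun ζ : ℂ => G ‖ζ / (2 * Real.pi)‖ := by fun_prop
  have hlim := ProbabilityMeasure.tendsto_iff_forall_integral_tendsto.1
    ((seriesSum_spec ω φ).2.tendstoInDistribution hmeas).tendsto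
    (BoundedContinuousFunction.ofNormedAddCommGroup _ hcont K fun ζ => hK _)
  refine (hlim.congr fun s => ?_).trans_eq (congrArg 𝓝 ?_)
  · exact integral_map (hmeas s) hcont.aestronglyMeasurable
  · exact integral_map (seriesSum_spec ω φ).1.aemeasurable hcont.aestronglyMeasurable

end Mean

section Limit

variable {G : ℝ → ℝ} {L : NNReal} (hG : LipschitzWith L G) {K : ℝ} (hK : ∀ r, |G r| ≤ K)
  {ι : Type*} {l : Filter ι} {N c : ι → ℕ} {d a : ι → ℤ} {δ : ι → ℝ}
  {C ω φ : ℝ}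
  (hdata : ∀ᶠ i in l, 0 < N i ∧ 0 < c i ∧ (d i : ZMod (c i)) * a i = 1 ∧
    (N i : ℝ) ^ 2 * |δ i| ≤ C)
  (hω : Tendsto (fun i => (a i : ℝ) / c i) l (𝓝 ω))
  (hφ : Tendsto (fun i => Int.fract ((N i : ℝ) / c i)) l (𝓝 φ))
  (hc : Tendsto (fun i => (c i : ℝ) / N i) l (𝓝 0))
include hG hK hdata hω hφ hc

theorem tendsto_integral_coefSum_sub_truncMean (s : Finset ℤ) {y : ℝ}
    (hy : y ∈ Set.Ioo (0 : ℝ) 1) :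
    Tendsto (fun i => ∫ x, G ‖coefSum (N i) (c i) (d i) (δ i) s y x‖ ∂unif -
      truncMean G ω φ s (N i / c i * y + (1 / 2 - δ i * (N i * (N i - 1) / 2))) y) l (𝓝 0) := by
  set T : ι → ℝ := fun i => N i / c i * y + (1 / 2 - δ i * (N i * (N i - 1) / 2))
  have hparam := tendsto_sub_of_tendstoUniformly (tendstoUniformly_truncMean s
    hG.uniformContinuous hK hy hω hφ (tendsto_const_nhds (x := y))) T
  have hcompare : Tendsto (fun i => ∫ x, G ‖coefSum (N i) (c i) (d i) (δ i) s y x‖ ∂unif -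
      truncMean G (a i / c i) (Int.fract (N i / c i)) s (T i) y) l (𝓝 0) := by
    have hbound : Tendsto (fun i => (L : ℝ) * ((∑ j ∈ s,
        (4 * Real.pi * C + (2 * Real.pi * C) ^ 2) / (‖e (-y) - 1‖ * |(j : ℝ) - y|)) *
        ((c i : ℝ) / N i))) l (𝓝 0) := by
      simpa only [mul_zero] using (hc.const_mul _).const_mul (L : ℝ)
    refine squeeze_zero_norm' ?_ hbound
    filter_upwards [hdata] with i ⟨hN, hci, ha, hC⟩
    have : NeZero (c i) := ⟨hci.ne'⟩
    exact abs_integral_coefSum_sub_truncMean_le ha hC hy hN s hG hK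
  simpa only [sub_add_sub_cancel, add_zero] using hcompare.add hparam

variable [l.IsCountablyGenerated]

theorem tendsto_integral_coefSum (s : Finset ℤ) :
    Tendsto (fun i => ∫ y, ∫ x, G ‖coefSum (N i) (c i) (d i) (δ i) s y x‖ ∂unif ∂unif) l
      (𝓝 (∫ z, G ‖trunc ω φ s z‖ ∂unif3)) := by
  set κ : ι → ℝ := fun i => 1 / 2 - δ i * (N i * (N i - 1) / 2)
  have hM : Tendsto (fun i => (N i : ℝ) / c i) l atTop := by
    have hpos : Tendsto (fun i => (c i : ℝ) / N i) l (𝓝[>] 0) := by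
      refine tendsto_nhdsWithin_iff.2 ⟨hc, hdata.mono fun i ⟨hN, hci, _⟩ => Set.mem_Ioi.2 ?_⟩
      positivity
    exact hpos.inv_tendsto_nhdsGT_zero.congr fun i => inv_div _ _
  have hmean := tendsto_integral_truncMean hG hK ω φ s hM κ
  have hcoefSum : ∀ i, Integrable
      (fun y => ∫ x, G ‖coefSum (N i) (c i) (d i) (δ i) s y x‖ ∂unif) unif := fun i =>
    integrable_integral_comp_norm hG.continuous hK (measurable_coefSum ..)
  have htruncMean : ∀ i, Integrable
      (fun y => truncMean G ω φ s (N i / c i * y + κ i) y) unif := fun i =>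
    integrable_integral_comp_norm (P := fun y x => trunc ω φ s (N i / c i * y + κ i, x, y))
      hG.continuous hK ((measurable_trunc ω φ s).comp (by fun_prop))
  have hdiff := tendsto_integral_filter_of_dominated_convergence (μ := unif) (f := fun _ => (0 : ℝ))
    (fun _ => K + K)
    (Eventually.of_forall fun i => ((hcoefSum i).sub (htruncMean i)).aestronglyMeasurable)
    (Eventually.of_forall fun i => ae_of_all _ fun y => norm_sub_le_of_le
      (norm_integral_le_of_ae_bound (ae_of_all _ fun x => hK _)) (abs_truncMean_le s hK ω φ _ _))
    (integrable_const _)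
    (ae_unif_mem_Ioo.mono fun y hy =>
      tendsto_integral_coefSum_sub_truncMean hG hK hdata hω hφ hc s hy)
  rw [integral_zero] at hdiff
  refine (by simpa only [zero_add] using hdiff.add hmean : Tendsto _ l _).congr fun i => ?_
  simp only [Pi.sub_apply, integral_sub (hcoefSum i) (htruncMean i), sub_add_cancel]

/-- The truncation error is small uniformly in `i`, so the limits in `s` and `i` commute. -/
theorem tendsto_integral_profile :
    Tendsto (fun i => ∫ y, ∫ x, G ‖profile (N i) (c i) (d i) (δ i) y x‖ ∂unif ∂unif) l
      (𝓝 (∫ z, G ‖seriesSum ω φ z / (2 * Real.pi)‖ ∂unif3)) := by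
  refine TendstoUniformlyOnFilter.tendsto_of_eventually_tendsto (p := atTop) ?_
    (Eventually.of_forall (tendsto_integral_coefSum hG hK hdata hω hφ hc))
    (tendsto_integral_trunc hG.continuous hK ω φ)
  have htail : Tendsto (fun s : Finset ℤ => L * (2 * (2 + 2 * Real.pi * C) *
      √(∑' j : {j // j ∉ s}, 1 / (j : ℝ) ^ 2))) atTop (𝓝 0) := by
    have hsqrt := (tendsto_tsum_compl_atTop_zero fun j : ℤ => 1 / (j : ℝ) ^ 2).sqrt
    simpa only [Real.sqrt_zero, mul_zero] using (hsqrt.const_mul _).const_mul (L : ℝ)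
  refine Metric.tendstoUniformlyOnFilter_iff.2 fun ε hε => ?_
  refine (((htail.eventually_lt_const hε).and (eventually_ge_atTop {0, 1})).prod_mk hdata).mono ?_
  rintro ⟨s, i⟩ ⟨⟨hs, h01⟩, -, hci, ha, hC⟩
  have : NeZero (c i) := ⟨hci.ne'⟩
  exact (abs_integral_profile_sub_coefSum_le hG hK (IsUnit.of_mul_eq_one _ ha) hC
    (h01 (by simp)) (h01 (by simp))).trans_lt hs

theorem tendsto_integral_circleSum :
    Tendsto (fun i => ∫ s, G ‖circleSum (N i) (-d i / c i + δ i) s / √(c i)‖ ∂unif) l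
      (𝓝 (∫ z, G ‖seriesSum ω φ z / (2 * Real.pi)‖ ∂unif3)) := by
  refine (tendsto_integral_profile hG hK hdata hω hφ hc).congr' ?_
  filter_upwards [hdata] with i ⟨_, hci, ha, _⟩
  have : NeZero (c i) := ⟨hci.ne'⟩
  exact (integral_circleSum_eq (N i) (δ i) hG.continuous hK (IsUnit.of_mul_eq_one _ ha)).symm

end Limit

/-! ### The arithmetic data -/

theorem cN_mem {N : ℕ} (hN : 0 < N) (u : ℝ) :
    0 < cN N u ∧ distInt (cN N u * u) ≤ (N : ℝ)⁻¹ := by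
  have hne : {c : ℕ | 0 < c ∧ distInt (c * u) ≤ (N : ℝ)⁻¹}.Nonempty := by
    obtain ⟨c, hc, -, hdist⟩ := Real.exists_nat_abs_mul_sub_round_le u hN
    refine ⟨c, hc, hdist.trans ?_⟩
    rw [← one_div]
    gcongr
    linarith
  exact Nat.sInf_mem hne

theorem distInt_le_abs_add (x : ℝ) (m : ℤ) : distInt x ≤ |x + m| := by
  simpa only [distInt, Int.cast_neg, sub_neg_eq_add] using round_le x (-m)

theorem abs_add_dN (N : ℕ) (u : ℝ) : |(cN N u : ℝ) * u + dN N u| = distInt (cN N u * u) := by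
  rw [distInt, dN, round_eq, Int.cast_neg, sub_eq_add_neg]

/-- A common factor `r` could be divided out of `c_N(u)` and `d_N(u)`, against minimality. -/
theorem isCoprime_dN {N : ℕ} (hN : 0 < N) (u : ℝ) : IsCoprime (dN N u) (cN N u : ℤ) := by
  obtain ⟨hcpos, hcdist⟩ := cN_mem hN u
  rw [Int.isCoprime_iff_gcd_eq_one]
  by_contra hgcd
  obtain ⟨d', hd⟩ : (Int.gcd (dN N u) (cN N u) : ℤ) ∣ dN N u := Int.gcd_dvd_left ..
  obtain ⟨c', hc⟩ : Int.gcd (dN N u) (cN N u) ∣ cN N u :=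
    Int.natCast_dvd_natCast.1 (Int.gcd_dvd_right ..)
  have hr : 0 < Int.gcd (dN N u) (cN N u) :=
    Int.gcd_pos_of_ne_zero_right _ (by exact_mod_cast hcpos.ne')
  generalize Int.gcd (dN N u) (cN N u) = r at *
  have hc' : 0 < c' := pos_of_mul_pos_right (hc ▸ hcpos) r.zero_le
  have hlt : c' < cN N u := by
    rw [hc]
    exact lt_mul_of_one_lt_left hc' (by omega)
  refine Nat.notMem_of_lt_sInf hlt ⟨hc', ?_⟩
  have hcR : (cN N u : ℝ) = r * c' := by exact_mod_cast hc
  have hdR : (dN N u : ℝ) = r * d' := by exact_mod_cast hd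
  calc distInt (c' * u) ≤ |(c' : ℝ) * u + d'| := distInt_le_abs_add _ _
    _ ≤ r * |(c' : ℝ) * u + d'| := le_mul_of_one_le_left (abs_nonneg _) (by exact_mod_cast hr)
    _ = |(cN N u : ℝ) * u + dN N u| := by
      rw [hcR, hdR, mul_assoc, ← mul_add, abs_mul, Nat.abs_cast]
    _ = distInt (cN N u * u) := abs_add_dN N u
    _ ≤ (N : ℝ)⁻¹ := hcdist

theorem dN_mul_aN {N : ℕ} (hN : 0 < N) (u : ℝ) :
    (dN N u : ZMod (cN N u)) * (aN N u : ℤ) = 1 := by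
  have : NeZero (cN N u) := ⟨(cN_mem hN u).1.ne'⟩
  have hunit : IsUnit (dN N u : ZMod (cN N u)) :=
    (ZMod.coe_int_isUnit_iff_isCoprime _ _).2 (isCoprime_dN hN u).symm
  rw [Int.cast_natCast, aN, ZMod.natCast_zmod_val, ZMod.mul_inv_of_unit _ hunit]

theorem fract_aN_div {N : ℕ} (hN : 0 < N) (u : ℝ) :
    Int.fract ((aN N u : ℝ) / cN N u) = aN N u / cN N u := by
  have : NeZero (cN N u) := ⟨(cN_mem hN u).1.ne'⟩
  have hc : (0 : ℝ) < cN N u := by exact_mod_cast (cN_mem hN u).1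
  refine Int.fract_eq_self.2 ⟨by positivity, ?_⟩
  rw [div_lt_one hc]
  exact_mod_cast ZMod.val_lt _

/-- The deviation of `u` from its rational approximation `-d_N(u) / c_N(u)`. -/
def approxError (N : ℕ) (u : ℝ) : ℝ := u + dN N u / cN N u

theorem neg_dN_div_add_approxError (N : ℕ) (u : ℝ) : -dN N u / cN N u + approxError N u = u := by
  rw [approxError]
  ring

theorem abs_approxError {N : ℕ} (hN : 0 < N) (u : ℝ) :
    |approxError N u| = distInt (cN N u * u) / cN N u := by
  have hc : (cN N u : ℝ) ≠ 0 := by exact_mod_cast (cN_mem hN u).1.ne'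
  rw [← abs_add_dN, approxError, ← Nat.abs_cast (cN N u), ← abs_div, Nat.abs_cast, add_div,
    mul_div_cancel_left₀ _ hc]

theorem exists_bound_of_dist_le {F : ℂ → ℝ} {C : ℝ} (hC : ∀ x y, dist (F x) (F y) ≤ C) :
    ∃ K, ∀ ζ, |F ζ| ≤ K := by
  refine ⟨|F 0| + C, fun ζ => ?_⟩
  rw [← Real.norm_eq_abs, ← Real.norm_eq_abs]
  exact norm_le_of_mem_closedBall (hC ζ 0)

end SkewSums

end

theorem mainTheorem5 (α : ℝ) (k l : ℤ) (hl : l ≠ 0) (u : ℝ) (hu : u = (l : ℝ) * α)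
    (N : ℕ → ℕ) (hN : Tendsto N atTop atTop) (ω φ : ℝ)
    (hφ : Tendsto (fun i => Int.fract ((N i : ℝ) / (SkewSums.cN (N i) u : ℝ))) atTop (𝓝 φ))
    (hω : Tendsto (fun i => Int.fract ((SkewSums.aN (N i) u : ℝ) / (SkewSums.cN (N i) u : ℝ)))
      atTop (𝓝 ω))
    (hc : Tendsto (fun i => (SkewSums.cN (N i) u : ℝ) / (N i : ℝ)) atTop (𝓝 0))
    (hb : IsBoundedUnder (· ≤ ·) atTop fun i =>
      (N i : ℝ) ^ 2 * SkewSums.distInt ((SkewSums.cN (N i) u : ℝ) * u) /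
        (SkewSums.cN (N i) u : ℝ)) :
    Tendsto (fun i => SkewSums.rhoTilde (N i) α k l) atTop (𝓝 (SkewSums.nu ω φ)) := by
  open SkewSums in
  rw [tendsto_iff_forall_lipschitz_integral_tendsto]
  rintro F ⟨B, hB⟩ ⟨L, hF⟩
  obtain ⟨K, hK⟩ := exists_bound_of_dist_le hB
  obtain ⟨C, hC⟩ := hb
  have hpos : ∀ᶠ i in atTop, 0 < N i := hN.eventually_gt_atTop 0
  have hdata : ∀ᶠ i in atTop, 0 < N i ∧ 0 < cN (N i) u ∧
      (dN (N i) u : ZMod (cN (N i) u)) * (aN (N i) u : ℤ) = 1 ∧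
      (N i : ℝ) ^ 2 * |approxError (N i) u| ≤ C := by
    filter_upwards [hpos, eventually_map.1 hC] with i hi hCi
    refine ⟨hi, (cN_mem hi u).1, dN_mul_aN hi u, ?_⟩
    rwa [abs_approxError hi, ← mul_div_assoc]
  have hω' : Tendsto (fun i => ((aN (N i) u : ℤ) : ℝ) / cN (N i) u) atTop (𝓝 ω) :=
    hω.congr' (hpos.mono fun i hi => by simp only [fract_aN_div hi, Int.cast_natCast])
  have hlim := tendsto_integral_circleSum (lipschitzWith_circleAverage hF)
    (abs_circleAverage_le hK) hdata hω' hφ hc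
  simpa only [integral_rhoTilde hF.continuous hK _ _ _ hl, integral_nu hF.continuous hK, ← hu,
    neg_dN_div_add_approxError] using hlim
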